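/- Conventions. Maps are continuous unless said otherwise; $S^i=\partial B^{i+1}$ is the unit sphere and $B^{i+1}$ the closed unit ball of $\mathbb R^{i+1}$ ($i\ge 0$). A metric space is proper if its closed balls are compact. A metric space $(X,d)$ is \emph{uniformly $n$-connected} if for every $0\le i\le n$ and every $r>0$ there is $R>0$ such that for every $x\in X$ every map $S^i\to N_r(x)$ extends to a map $B^{i+1}\to N_R(x)$, where $N_r(x)$ is the $r$-ball about $x$. We write $\pi_i^\infty(X)=0$ if for every compact $K\subseteq X$ there is a compact $L$ with $K\subseteq L\subseteq X$ such that every map $S^i\to X\setminus L$ extends to a map $B^{i+1}\to X\setminus K$. For $C\subseteq X$ the Rips complex $P_r(C)$ has as simplices the nonempty finite subsets of $C$ with pairwise distances at most $r$. For $C\subseteq D\subseteq X$, $C$ is \emph{$(i;r,R)$-aspherical in $D$} if for every triangulation $S$ of $S^i$, every simplicial map $f\colon S\to P_r(C)$ has a simplicial extension $F\colon B\to P_R(D)$ for some triangulation $B$ of $B^{i+1}$ with $\partial B=S$. We write $\mathrm{as}\text{-}\pi_i^\infty(X)=0$ if for every $r>0$ there is $R>0$ such that for every bounded $K\subseteq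 X$ there is a bounded $L\subseteq X$ containing $K$ for which $X\setminus L$ is $(i;r,R)$-aspherical in $X\setminus K$. Metric spaces $(X,d)$ and $(X',d')$ are \emph{uniformly equivalent} if there are a (not necessarily continuous) function $h\colon X\to X'$, nondecreasing functions $g_1,g_2\colon\mathbb R\to\mathbb R$ with $g_j(t)\to\infty$ as $t\to\infty$, and $N>0$ such that $g_1(d(x,y))\le d'(h(x),h(y))\le g_2(d(x,y))$ for all $x,y\in X$, and every $z\in X'$ satisfies $d'(z,h(w))\le N$ for some $w\in X$. Theorem. Let $n\ge 0$ be an integer. (1) If $X$ is a uniformly $n$-connected proper metric space, then for every $0\le i\le n$: $\ \mathrm{as}\text{-}\pi_i^\infty(X)=0$ if and only if $\pi_i^\infty(X)=0$. (2) If $X$ and $X'$ are uniformly $n$-connected proper metric spaces that are uniformly equivalent, then for every $0\le i\le n$: $\ \pi_i^\infty(X)=0$ if and only if $\pi_i^\infty(X')=0$. -/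

import Mathlib

/-- The unit sphere `S^i` in Euclidean `(i+1)`-space. -/
abbrev USphere (i : ℕ) : Set (EuclideanSpace ℝ (Fin (i + 1))) := Metric.sphere 0 1

/-- The closed unit ball `B^{i+1}` in Euclidean `(i+1)`-space; its boundary is `USphere i`. -/
abbrev UBall (i : ℕ) : Set (EuclideanSpace ℝ (Fin (i + 1))) := Metric.closedBall 0 1

/-- The inclusion of `S^i = ∂B^{i+1}` into `B^{i+1}`. -/
def sphereInclusion (i : ℕ) (x : USphere i) : UBall i :=
  ⟨x.1, Metric.sphere_subset_closedBall x.2⟩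

/-- Every continuous map `S^i → C` extends to a continuous map `B^{i+1} → D`
(maps into subsets of `X` are maps into `X` with image in the subset). -/
def SphereMapsExtend {X : Type*} [TopologicalSpace X] (i : ℕ) (C D : Set X) : Prop :=
  ∀ f : C(USphere i, X), (∀ x, f x ∈ C) →
    ∃ F : C(UBall i, X), (∀ y, F y ∈ D) ∧ ∀ x, F (sphereInclusion i x) = f x

/-- `X` is uniformly `n`-connected. -/
def UniformlyConnected (n : ℕ) (X : Type*) [MetricSpace X] : Prop :=
  ∀ i ≤ n, ∀ r : ℝ, 0 < r → ∃ R : ℝ, 0 < R ∧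
    ∀ x : X, SphereMapsExtend i (Metric.ball x r) (Metric.ball x R)

/-- `π_i^∞(X) = 0`. -/
def PiInftyVanishes (i : ℕ) (X : Type*) [TopologicalSpace X] : Prop :=
  ∀ K : Set X, IsCompact K → ∃ L : Set X, IsCompact L ∧ K ⊆ L ∧ SphereMapsExtend i Lᶜ Kᶜ

/-- The Rips complex `P_r(C)` of a subset `C` of a metric space `X`: its simplices are the nonempty
finite subsets of `C` whose points are pairwise at distance at most `r`. -/
def ripsComplex {X : Type*} [MetricSpace X] (r : ℝ) (C : Set X) : PreAbstractSimplicialComplex X where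
  faces := {s | s.Nonempty ∧ (s : Set X) ⊆ C ∧ ∀ x ∈ s, ∀ y ∈ s, dist x y ≤ r}
  isRelLowerSet_faces := fun _ hs =>
    ⟨hs.1, fun _ hts ht =>
      ⟨ht, fun _ hx => hs.2.1 (hts hx), fun x hx y hy => hs.2.2 x (hts hx) y (hts hy)⟩⟩

/-- The geometric realization, in barycentric coordinates, of a simplicial complex with vertices
in `ℕ`. (For finite complexes, the only ones used, the subspace topology of `ℕ → ℝ` is the usual
topology of the realization.) -/
def realization (K : PreAbstractSimplicialComplex ℕ) : Set (ℕ → ℝ) :=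
  {x | ∃ s ∈ K.faces, (∀ v, 0 ≤ x v) ∧ (∀ v, v ∉ s → x v = 0) ∧ ∑ v ∈ s, x v = 1}

/-- A (finite) triangulation of a compact space `Y`: a finite simplicial complex with a
homeomorphism of its geometric realization onto `Y`. As the complex is finite, it is no
restriction that its vertices are natural numbers. -/
structure Triangulation (Y : Type*) [TopologicalSpace Y] where
  complex : PreAbstractSimplicialComplex ℕ
  finite_faces : complex.faces.Finite
  homeo : realization complex ≃ₜ Y

/-- `∂B = S`: the triangulation `S` of the sphere `S^i` is the restriction to `S^i = ∂B^{i+1}` of the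
triangulation `B` of the ball `B^{i+1}`. -/
def IsBoundaryTriangulation {i : ℕ} (S : Triangulation (USphere i)) (B : Triangulation (UBall i)) :
    Prop :=
  S.complex ≤ B.complex ∧
    ∀ (x : ℕ → ℝ) (hS : x ∈ realization S.complex) (hB : x ∈ realization B.complex),
      B.homeo ⟨x, hB⟩ = sphereInclusion i (S.homeo ⟨x, hS⟩)

open Classical in
/-- `f` is (the vertex map of) a simplicial map `K → L`. Only the values of `f` at the vertices
of `K` matter. -/
def IsSimplicialMap {V W : Type*} (K : PreAbstractSimplicialComplex V)
    (L : PreAbstractSimplicialComplex W) (f : V → W) : Prop :=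
  ∀ s ∈ K.faces, s.image f ∈ L.faces

/-- `C` is `(i; r, R)`-aspherical in `D`. -/
def IsAsphericalIn {X : Type*} [MetricSpace X] (i : ℕ) (r R : ℝ) (C D : Set X) : Prop :=
  ∀ (S : Triangulation (USphere i)) (f : ℕ → X),
    IsSimplicialMap S.complex (ripsComplex r C) f →
    ∃ (B : Triangulation (UBall i)) (F : ℕ → X),
      IsBoundaryTriangulation S B ∧ IsSimplicialMap B.complex (ripsComplex R D) F ∧
      ∀ v : ℕ, {v} ∈ S.complex.faces → F v = f v

/-- `as-π_i^∞(X) = 0`. -/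
def AsPiInftyVanishes (i : ℕ) (X : Type*) [MetricSpace X] : Prop :=
  ∀ r : ℝ, 0 < r → ∃ R : ℝ, 0 < R ∧ ∀ K : Set X, Bornology.IsBounded K →
    ∃ L : Set X, Bornology.IsBounded L ∧ K ⊆ L ∧ IsAsphericalIn i r R Lᶜ Kᶜ

/-- `h` is a `(g₁, g₂)`-uniform embedding. -/
def IsUniformEmbeddingWith {X Y : Type*} [MetricSpace X] [MetricSpace Y] (g₁ g₂ : ℝ → ℝ)
    (h : X → Y) : Prop :=
  ∀ x y : X, g₁ (dist x y) ≤ dist (h x) (h y) ∧ dist (h x) (h y) ≤ g₂ (dist x y)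

/-- `X` and `Y` are uniformly equivalent: there is a (not necessarily continuous)
`(g₁, g₂, N)`-uniform equivalence `X → Y` for some nondecreasing `g₁`, `g₂` tending to infinity
and some `N > 0`. -/
def UniformlyEquivalent (X Y : Type*) [MetricSpace X] [MetricSpace Y] : Prop :=
  ∃ (h : X → Y) (g₁ g₂ : ℝ → ℝ) (N : ℝ),
    Monotone g₁ ∧ Monotone g₂ ∧
    Filter.Tendsto g₁ Filter.atTop Filter.atTop ∧ Filter.Tendsto g₂ Filter.atTop Filter.atTop ∧
    0 < N ∧ IsUniformEmbeddingWith g₁ g₂ h ∧ ∀ z : Y, ∃ w : X, dist z (h w) ≤ N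

open Set Filter Topology

/-! Up to bounded errors, simplicial maps into Rips complexes and continuous maps into a uniformly
`n`-connected space carry the same information. A continuous map gives a simplicial one by
evaluation at the vertices of a fine triangulation. Conversely, sending a point to the image of a
vertex of its carrier gives a coarsely continuous map, and by `exists_continuous_near` such a map is
close to a continuous one, with an error that depends on its jumps and not on the scale at which
they occur. That lemma cuts the ball into small cubes and extends over the skeleta one dimension at
a time (`Grid.exists_extend`); uniform connectedness bounds the error at each of the finitely many
stages.

Suppose the asymptotic condition holds. A map of the sphere far from `K` is discretized, extended
simplicially over the ball away from a large neighbourhood of `K`, and made continuous again without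
changing it on the boundary; the error is too small to reach `K`.

Conversely, a simplicial map on a triangulated sphere is made continuous, extended over the ball,
and discretized. Here the triangulation `S` of the boundary is prescribed and may be coarse, so the
simplices of the ball near the boundary cannot be small. The remedy is `exists_ball_triangulation`:
the cone on `S` is subdivided barycentrically relative to `S` until each simplex is small or lies in
the outer half of the cone on one simplex of `S`. The extension is first precomposed with
`radialPush`, which collapses the outer half radially to the sphere; a simplex of the second kind is
then controlled by one simplex of `S`.

The asymptotic condition involves no continuity in the space, so it passes through coarse inverses
(`AsPiInftyVanishes.transfer`). Together with the equivalence of the two conditions this gives the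
invariance of the topological one. -/

/-- Simplicial complexes with vertices in `ℕ`. -/
abbrev NatComplex := PreAbstractSimplicialComplex ℕ

/-! ### Faces and geometric realizations of finite complexes -/

namespace NatComplex

variable {K L : NatComplex}

theorem face_nonempty {s : Finset ℕ} (hs : s ∈ K.faces) : s.Nonempty :=
  K.isRelLowerSet_faces.prop_of_mem hs

theorem face_subset {s t : Finset ℕ} (hs : s ∈ K.faces) (hts : t ⊆ s) (ht : t.Nonempty) :
    t ∈ K.faces :=
  K.isRelLowerSet_faces.mem_of_le hs hts ht

theorem singleton_face {s : Finset ℕ} (hs : s ∈ K.faces) {v : ℕ} (hv : v ∈ s) :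
    {v} ∈ K.faces :=
  face_subset hs (Finset.singleton_subset_iff.2 hv) (Finset.singleton_nonempty v)

theorem exists_vertex_bound (hK : K.faces.Finite) :
    ∃ M : ℕ, ∀ s ∈ K.faces, ∀ v ∈ s, v < M := by
  refine ⟨(hK.toFinset.sup id).sup id + 1, fun s hs v hv => Nat.lt_succ_of_le ?_⟩
  have h1 : s ≤ hK.toFinset.sup id := Finset.le_sup (f := id) (hK.mem_toFinset.2 hs)
  exact Finset.le_sup (f := id) (h1 hv)

/-- A point of the realization is a convex combination of the vertices of its support. -/
theorem exists_support {x : ℕ → ℝ} (hx : x ∈ realization K) :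
    ∃ t ∈ K.faces, (∀ v, v ∈ t ↔ 0 < x v) ∧ (∀ v, 0 ≤ x v) ∧ ∑ v ∈ t, x v = 1 := by
  classical
  obtain ⟨s, hs, h0, hout, hsum⟩ := hx
  have key : ∑ v ∈ s with 0 < x v, x v = 1 := by
    rw [← hsum, Finset.sum_filter]
    refine Finset.sum_congr rfl fun v _ => ?_
    split_ifs with h
    · rfl
    · exact le_antisymm (h0 v) (not_lt.1 h)
  refine ⟨s.filter fun v => 0 < x v, ?_, ?_, h0, key⟩
  · refine face_subset hs (Finset.filter_subset _ _) ?_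
    rw [Finset.nonempty_iff_ne_empty]
    intro h
    rw [h] at key
    simp at key
  · intro v
    rw [Finset.mem_filter]
    refine ⟨fun h => h.2, fun h => ⟨?_, h⟩⟩
    by_contra hv
    exact h.ne' (hout v hv)

theorem realization_nonneg {x : ℕ → ℝ} (hx : x ∈ realization K) (v : ℕ) : 0 ≤ x v := by
  obtain ⟨s, -, h, -⟩ := hx
  exact h v

theorem realization_le_one {x : ℕ → ℝ} (hx : x ∈ realization K) (v : ℕ) : x v ≤ 1 := by
  obtain ⟨s, -, h0, hout, hsum⟩ := hx
  by_cases hv : v ∈ s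
  · rw [← hsum]
    exact Finset.single_le_sum (fun u _ => h0 u) hv
  · rw [hout v hv]
    exact zero_le_one

theorem singleton_face_of_pos {x : ℕ → ℝ} (hx : x ∈ realization K) {v : ℕ} (hv : 0 < x v) :
    {v} ∈ K.faces := by
  obtain ⟨t, ht, hpos, -⟩ := exists_support hx
  exact singleton_face ht ((hpos v).2 hv)

theorem realization_mono (h : K ≤ L) : realization K ⊆ realization L :=
  fun _ ⟨s, hs, hx⟩ => ⟨s, h hs, hx⟩

theorem vertex_mem_realization {v : ℕ} (hv : {v} ∈ K.faces) :
    (Pi.single v 1 : ℕ → ℝ) ∈ realization K := by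
  refine ⟨{v}, hv, fun u => ?_, fun u hu => ?_, by simp⟩
  · by_cases h : u = v
    · subst h; simp
    · simp [h]
  · exact Pi.single_eq_of_ne (by simpa using hu) _

/-- The realization is a finite union of closed simplices, each closed in the product cube, which is
compact by Tychonoff. -/
theorem isCompact_realization (hK : K.faces.Finite) : IsCompact (realization K) := by
  have : realization K = ⋃ s ∈ K.faces,
      {x : ℕ → ℝ | (∀ v, 0 ≤ x v) ∧ (∀ v, v ∉ s → x v = 0) ∧ ∑ v ∈ s, x v = 1} := by
    ext x; simp only [realization, mem_iUnion, exists_prop, mem_ofPred_eq]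
  rw [this]
  refine hK.isCompact_biUnion fun s _ => ?_
  refine IsCompact.of_isClosed_subset (s := Icc (0 : ℕ → ℝ) 1) isCompact_Icc ?_ ?_
  · simp only [ofPred_and, ofPred_forall]
    refine IsClosed.inter (isClosed_iInter fun v =>
      isClosed_le continuous_const (continuous_apply v)) (IsClosed.inter (isClosed_iInter fun v =>
        isClosed_iInter fun _ => isClosed_eq (continuous_apply v) continuous_const) ?_)
    exact isClosed_eq (continuous_finsetSum _ fun v _ => continuous_apply v) continuous_const
  · rintro x ⟨h0, hout, hsum⟩
    refine ⟨h0, fun v => ?_⟩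
    by_cases hv : v ∈ s
    · rw [Pi.one_apply, ← hsum]
      exact Finset.single_le_sum (fun u _ => h0 u) hv
    · rw [hout v hv]
      exact zero_le_one

/-- A continuous bijection from the realization of a finite complex to a Hausdorff space is
a triangulation. -/
noncomputable def triangulationOfBijective {Y : Type*} [TopologicalSpace Y] [T2Space Y]
    (hK : K.faces.Finite) (f : realization K → Y) (hf : Continuous f)
    (hbij : Function.Bijective f) : Triangulation Y where
  complex := K
  finite_faces := hK
  homeo :=
    haveI : CompactSpace (realization K) := isCompact_iff_compactSpace.1 (isCompact_realization hK)
    Continuous.homeoOfEquivCompactToT2 (f := Equiv.ofBijective f hbij) hf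

/-- A continuous function on a compact space of barycentric coordinates is uniformly continuous
with respect to the differences of coordinates. -/
theorem exists_coord_modulus {X : Type*} [PseudoMetricSpace X] {C : Set (ℕ → ℝ)}
    (hC : IsCompact C) {H : C → X} (hH : Continuous H) {δ : ℝ} (hδ : 0 < δ) :
    ∃ ε > 0, ∀ x y : C, (∀ v, |x.1 v - y.1 v| ≤ ε) → dist (H x) (H y) < δ := by
  by_contra! hcon
  have : CompactSpace C := isCompact_iff_compactSpace.1 hC
  choose x y hxy hd using fun n : ℕ => hcon (1 / ((n : ℝ) + 1)) (by positivity)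
  obtain ⟨a, -, φ, hφ, ha⟩ := isCompact_univ.tendsto_subseq (x := x) fun _ => mem_univ _
  -- Convergence in the product is coordinatewise, so the uniform bound on coordinate differences
  -- forces the same limit.
  have hb : Tendsto (y ∘ φ) atTop (𝓝 a) := by
    rw [tendsto_subtype_rng, tendsto_pi_nhds] at ha ⊢
    intro v
    have h1 : Tendsto (fun n => (x (φ n)).1 v - (y (φ n)).1 v) atTop (𝓝 0) := by
      refine squeeze_zero_norm (a := fun n => 1 / (((φ n : ℕ) : ℝ) + 1)) (fun n => ?_) ?_
      · exact hxy (φ n) v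
      · exact tendsto_one_div_add_atTop_nhds_zero_nat.comp hφ.tendsto_atTop
    simpa using (ha v).sub h1
  have h2 : Tendsto (fun n => dist (H (x (φ n))) (H (y (φ n)))) atTop (𝓝 (dist (H a) (H a))) :=
    ((hH.tendsto a).comp ha).dist ((hH.tendsto a).comp hb)
  rw [dist_self] at h2
  exact absurd (ge_of_tendsto' h2 fun n => hd (φ n)) (not_le.2 hδ)

end NatComplex

/-! ### Choosing a vertex of the carrier of each point -/

namespace Triangulation

open NatComplex

/-- The points of a triangulated compact metric space can be assigned vertices of their supports
so that close points receive vertices of a common simplex. -/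
theorem exists_vertex_choice {Y : Type*} [PseudoMetricSpace Y] [CompactSpace Y]
    (T : Triangulation Y) :
    ∃ φ : Y → ℕ, (∀ y, 0 < (T.homeo.symm y).1 (φ y)) ∧
      ∃ δ > 0, ∀ y z, dist y z < δ → ∃ s ∈ T.complex.faces, φ y ∈ s ∧ φ z ∈ s := by
  obtain ⟨M, hM⟩ := exists_vertex_bound T.finite_faces
  -- Pigeonhole: the coordinates sum to 1 over at most `M` vertices, so one of them is at least `1 /
  -- M`.
  have h1 : ∀ y, ∃ v < M, 1 ≤ (M : ℝ) * (T.homeo.symm y).1 v := by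
    intro y
    obtain ⟨t, ht, hpos, h0, hsum⟩ := exists_support (T.homeo.symm y).2
    by_contra! hcon
    have hlt : ∑ v ∈ t, (M : ℝ) * (T.homeo.symm y).1 v < ∑ v ∈ t, 1 :=
      Finset.sum_lt_sum_of_nonempty (face_nonempty ht) fun v hv => hcon v (hM t ht v hv)
    rw [← Finset.mul_sum, hsum, Finset.sum_const, nsmul_eq_mul, mul_one, mul_one] at hlt
    have hsub : t ⊆ Finset.range M := fun v hv => Finset.mem_range.2 (hM t ht v hv)
    have hcard := Finset.card_le_card hsub
    rw [Finset.card_range] at hcard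
    exact absurd hlt (not_lt.2 (by exact_mod_cast hcard))
  choose φ hφM hφ using h1
  have hMpos : ∀ y, 0 < (M : ℝ) := fun y => by exact_mod_cast lt_of_le_of_lt (Nat.zero_le _) (hφM y)
  have hpos : ∀ y, 0 < (T.homeo.symm y).1 (φ y) := by
    intro y
    by_contra h
    have := mul_nonpos_of_nonneg_of_nonpos (hMpos y).le (not_lt.1 h)
    linarith [hφ y]
  refine ⟨φ, hpos, ?_⟩
  have hcont : ∀ v, UniformContinuous fun y => (T.homeo.symm y).1 v := fun v =>
    CompactSpace.uniformContinuous_of_continuous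
      ((continuous_apply v).comp (continuous_subtype_val.comp T.homeo.symm.continuous))
  -- The tolerance `1 / (M + 1)` is below `1 / M`. Hence the coordinate at `φ z` stays positive when
  -- `z` is replaced by a nearby `y`, and the support of `y` contains both `φ y` and `φ z`.
  have hδ : ∀ v, ∃ δ > 0, ∀ y z, dist y z < δ →
      dist ((T.homeo.symm y).1 v) ((T.homeo.symm z).1 v) < 1 / ((M : ℝ) + 1) := fun v => by
    obtain ⟨δ, h, h'⟩ := Metric.uniformContinuous_iff.1 (hcont v) (1 / ((M : ℝ) + 1)) (by positivity)
    exact ⟨δ, h, fun y z hyz => h' hyz⟩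
  choose δ hδpos hδ using hδ
  obtain ⟨η, hη, hηle⟩ : ∃ η > 0, ∀ v < M, η ≤ δ v := by
    clear hφM hφ hMpos hpos hM
    induction M with
    | zero => exact ⟨1, one_pos, fun v hv => absurd hv (Nat.not_lt_zero v)⟩
    | succ M ih =>
      obtain ⟨η, hη, h⟩ := ih (fun v y z hyz => (hδ v y z hyz).trans_le
        (one_div_le_one_div_of_le (by positivity) (by push_cast; linarith)))
      refine ⟨min η (δ M), lt_min hη (hδpos M), fun v hv => ?_⟩
      rcases Nat.lt_succ_iff_lt_or_eq.1 hv with h' | rfl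
      · exact (min_le_left _ _).trans (h v h')
      · exact min_le_right _ _
  refine ⟨η, hη, fun y z hyz => ?_⟩
  obtain ⟨t, ht, htpos, -⟩ := exists_support (T.homeo.symm y).2
  refine ⟨t, ht, (htpos _).2 (hpos y), (htpos _).2 ?_⟩
  have h2 := hδ (φ z) y z (hyz.trans_le (hηle _ (hφM z)))
  rw [Real.dist_eq, abs_lt] at h2
  have h3 : 1 / ((M : ℝ) + 1) < (T.homeo.symm z).1 (φ z) := by
    rw [div_lt_iff₀ (by positivity)]
    nlinarith [hφ z, hpos z]
  linarith [h2.1]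

end Triangulation

namespace NatComplex

/-! ### Affine combinations -/

/-- The combination of the points `p v` with coefficients `y v`. -/
noncomputable def combo (p : ℕ → ℕ → ℝ) (y : ℕ → ℝ) : ℕ → ℝ :=
  fun w => ∑ᶠ v, y v * p v w

theorem combo_eq_sum {p : ℕ → ℕ → ℝ} {y : ℕ → ℝ} {s : Finset ℕ} (h : ∀ v, v ∉ s → y v = 0)
    (w : ℕ) : combo p y w = ∑ v ∈ s, y v * p v w := by
  refine finsum_eq_sum_of_support_subset _ fun v hv => ?_
  by_contra hvs
  refine hv ?_
  simp only [h v hvs, zero_mul]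

theorem combo_single {y : ℕ → ℝ} {s : Finset ℕ} (h : ∀ v, v ∉ s → y v = 0) :
    combo (fun v => Pi.single v 1) y = y := by
  ext w
  rw [combo_eq_sum h]
  by_cases hw : w ∈ s
  · rw [Finset.sum_eq_single w]
    · simp
    · intro v _ hv
      simp [hv.symm]
    · exact fun h' => absurd hw h'
  · rw [h w hw]
    refine Finset.sum_eq_zero fun v hv => ?_
    have : w ≠ v := fun h' => hw (h' ▸ hv)
    simp [this]

theorem combo_combo {p q : ℕ → ℕ → ℝ} {y : ℕ → ℝ} {s t : Finset ℕ} (h : ∀ v, v ∉ s → y v = 0)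
    (ht : ∀ v ∈ s, ∀ w, w ∉ t → q v w = 0) :
    combo p (combo q y) = combo (fun v => combo p (q v)) y := by
  have h1 : ∀ w, w ∉ t → combo q y w = 0 := by
    intro w hw
    rw [combo_eq_sum h]
    exact Finset.sum_eq_zero fun v hv => by rw [ht v hv w hw, mul_zero]
  ext u
  rw [combo_eq_sum h1, combo_eq_sum h]
  simp only [combo_eq_sum h, Finset.sum_mul]
  rw [Finset.sum_comm]
  refine Finset.sum_congr rfl fun v hv => ?_
  rw [combo_eq_sum (ht v hv), Finset.mul_sum]
  exact Finset.sum_congr rfl fun w _ => mul_assoc _ _ _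

theorem continuousOn_combo {K : NatComplex} (hK : K.faces.Finite) (p : ℕ → ℕ → ℝ) :
    ContinuousOn (combo p) (realization K) := by
  obtain ⟨M, hM⟩ := exists_vertex_bound hK
  have : Continuous fun (y : ℕ → ℝ) (w : ℕ) => ∑ v ∈ Finset.range M, y v * p v w :=
    continuous_pi fun w => continuous_finsetSum _ fun v _ =>
      (continuous_apply v).mul continuous_const
  refine this.continuousOn.congr fun y hy => ?_
  obtain ⟨s, hs, -, hout, -⟩ := hy
  ext w
  exact combo_eq_sum (fun v hv => hout v fun hvs => hv (Finset.mem_range.2 (hM s hs v hvs))) w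

/-! ### Averages -/

/-- The average of `q` over a finite set. -/
noncomputable def average (ρ : Finset ℕ) (q : ℕ → ℝ) : ℝ := (ρ.card : ℝ)⁻¹ * ∑ u ∈ ρ, q u

theorem average_const {ρ : Finset ℕ} (hρ : ρ.Nonempty) (c : ℝ) : average ρ (fun _ => c) = c := by
  have : (ρ.card : ℝ) ≠ 0 := by exact_mod_cast hρ.card_ne_zero
  rw [average, Finset.sum_const, nsmul_eq_mul, inv_mul_cancel_left₀ this]

theorem average_mono {ρ : Finset ℕ} {q q' : ℕ → ℝ} (h : ∀ u ∈ ρ, q u ≤ q' u) :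
    average ρ q ≤ average ρ q' :=
  mul_le_mul_of_nonneg_left (Finset.sum_le_sum h) (by positivity)

theorem average_le {ρ : Finset ℕ} (hρ : ρ.Nonempty) {q : ℕ → ℝ} {c : ℝ} (h : ∀ u ∈ ρ, q u ≤ c) :
    average ρ q ≤ c :=
  (average_mono h).trans (average_const hρ c).le

theorem average_sub {ρ : Finset ℕ} (q q' : ℕ → ℝ) :
    average ρ (fun u => q u - q' u) = average ρ q - average ρ q' := by
  rw [average, Finset.sum_sub_distrib, mul_sub, average, average]

theorem average_eq_zero {ρ : Finset ℕ} {q : ℕ → ℝ} (h : ∀ u ∈ ρ, q u = 0) : average ρ q = 0 := by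
  rw [average, Finset.sum_eq_zero h, mul_zero]

theorem average_nonneg {ρ : Finset ℕ} {q : ℕ → ℝ} (h : ∀ u ∈ ρ, 0 ≤ q u) : 0 ≤ average ρ q :=
  mul_nonneg (by positivity) (Finset.sum_nonneg h)

theorem abs_average_le {ρ : Finset ℕ} (q : ℕ → ℝ) : |average ρ q| ≤ average ρ fun u => |q u| := by
  rw [average, abs_mul, abs_of_nonneg (by positivity)]
  exact mul_le_mul_of_nonneg_left (Finset.abs_sum_le_sum_abs _ _) (by positivity)

/-- The term at `u₀` contributes nothing positive and has weight at least `1 / D`. This is the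
source of the contraction factor in all the estimates on subdivisions. -/
theorem average_le_of_zero {ρ : Finset ℕ} {D : ℕ} (hD : ρ.card ≤ D) {q : ℕ → ℝ} {c : ℝ}
    (hc : 0 ≤ c) (h : ∀ u ∈ ρ, q u ≤ c) {u₀ : ℕ} (hu : u₀ ∈ ρ) (h0 : q u₀ ≤ 0) :
    average ρ q ≤ (1 - (D : ℝ)⁻¹) * c := by
  have hcard : (1 : ℝ) ≤ ρ.card := by exact_mod_cast Finset.card_pos.2 ⟨u₀, hu⟩
  have h1 : ∑ u ∈ ρ, q u ≤ (ρ.card - 1 : ℝ) * c := by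
    rw [← Finset.add_sum_erase _ _ hu]
    have h2 : ∑ u ∈ ρ.erase u₀, q u ≤ (ρ.erase u₀).card • c :=
      Finset.sum_le_card_nsmul _ _ _ fun u hu' => h u (Finset.mem_of_mem_erase hu')
    rw [Finset.card_erase_of_mem hu, nsmul_eq_mul, Nat.cast_pred (by exact_mod_cast hcard)] at h2
    linarith
  have h3 : (D : ℝ)⁻¹ ≤ (ρ.card : ℝ)⁻¹ :=
    inv_anti₀ (by linarith) (by exact_mod_cast hD)
  calc average ρ q ≤ (ρ.card : ℝ)⁻¹ * ((ρ.card - 1 : ℝ) * c) :=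
        mul_le_mul_of_nonneg_left h1 (by positivity)
    _ = (1 - (ρ.card : ℝ)⁻¹) * c := by field_simp
    _ ≤ _ := mul_le_mul_of_nonneg_right (by linarith) hc

/-- The classical mesh estimate for barycentric subdivision: `q u - average τ q` averages the
differences `q u - q v`, and the one with `v = u` vanishes. -/
theorem abs_average_sub_average_le {ρ τ : Finset ℕ} {D : ℕ} (hρ : ρ.Nonempty) (hρτ : ρ ⊆ τ)
    (hD : τ.card ≤ D) {q : ℕ → ℝ} {ε : ℝ} (hε : 0 ≤ ε)
    (h : ∀ u ∈ τ, ∀ v ∈ τ, |q u - q v| ≤ ε) :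
    |average ρ q - average τ q| ≤ (1 - (D : ℝ)⁻¹) * ε := by
  have h1 : ∀ u ∈ ρ, |q u - average τ q| ≤ (1 - (D : ℝ)⁻¹) * ε := by
    intro u hu
    rw [← average_const (hρ.mono hρτ) (q u), ← average_sub]
    refine (abs_average_le _).trans (average_le_of_zero hD hε (h u (hρτ hu)) (hρτ hu) (by simp))
  rw [← average_const hρ (average τ q), ← average_sub]
  exact (abs_average_le _).trans (average_le hρ h1)

/-! ### The barycentric subdivision relative to a subcomplex -/

section RelSd

variable (K S : NatComplex) (enc : Finset ℕ → ℕ)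

/-- A face `σ` of `S` (or the empty set) followed by a chain of faces of `K` outside `S`. -/
structure IsRelFlag (σ : Finset ℕ) (C : Finset (Finset ℕ)) : Prop where
  base : σ = ∅ ∨ σ ∈ S.faces
  face : ∀ ρ ∈ C, ρ ∈ K.faces
  notMem : ∀ ρ ∈ C, ρ ∉ S.faces
  base_le : ∀ ρ ∈ C, σ ⊆ ρ
  chain : ∀ ρ ∈ C, ∀ τ ∈ C, ρ ⊆ τ ∨ τ ⊆ ρ

variable {K S} in
theorem IsRelFlag.mono {σ σ' : Finset ℕ} {C C' : Finset (Finset ℕ)} (h : IsRelFlag K S σ C)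
    (hσ : σ' ⊆ σ) (hC : C' ⊆ C) : IsRelFlag K S σ' C' where
  base := by
    rcases σ'.eq_empty_or_nonempty with h' | h'
    · exact Or.inl h'
    · rcases h.base with h0 | h0
      · subst h0
        exact absurd (Finset.subset_empty.1 hσ) h'.ne_empty
      · exact Or.inr (face_subset h0 hσ h')
  face ρ hρ := h.face ρ (hC hρ)
  notMem ρ hρ := h.notMem ρ (hC hρ)
  base_le ρ hρ := hσ.trans (h.base_le ρ (hC hρ))
  chain ρ hρ τ hτ := h.chain ρ (hC hρ) τ (hC hτ)

/-- The barycentric subdivision of `K` relative to `S`; the barycenter of a face `ρ` outside `S`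
is the vertex `enc ρ`. -/
def relSd : NatComplex where
  faces := {s | s.Nonempty ∧ ∃ σ C, IsRelFlag K S σ C ∧ s = σ ∪ C.image enc}
  isRelLowerSet_faces := by
    rintro s ⟨hs, σ, C, hfl, rfl⟩
    refine ⟨hs, fun t hts ht => ⟨ht, t ∩ σ, C.filter fun ρ => enc ρ ∈ t,
      hfl.mono Finset.inter_subset_right (Finset.filter_subset _ _), ?_⟩⟩
    ext v
    have := @hts v
    simp only [Finset.mem_union, Finset.mem_image, Finset.mem_inter, Finset.mem_filter] at this ⊢
    constructor
    · intro hv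
      rcases this hv with h | ⟨ρ, hρ, rfl⟩
      · exact Or.inl ⟨hv, h⟩
      · exact Or.inr ⟨ρ, ⟨hρ, hv⟩, rfl⟩
    · rintro (h | ⟨ρ, h, rfl⟩)
      · exact h.1
      · exact h.2

variable {K S enc}

theorem IsRelFlag.exists_top {σ : Finset ℕ} {C : Finset (Finset ℕ)} (h : IsRelFlag K S σ C)
    (hC : C.Nonempty) : ∃ τ ∈ C, ∀ ρ ∈ C, ρ ⊆ τ := by
  obtain ⟨τ, hτ, hmax⟩ := C.exists_max_image Finset.card hC
  refine ⟨τ, hτ, fun ρ hρ => ?_⟩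
  rcases h.chain ρ hρ τ hτ with h' | h'
  · exact h'
  · exact (Finset.eq_of_subset_of_card_le h' (hmax ρ hρ)).symm.subset

theorem relSd_finite (hK : K.faces.Finite) (hS : S ≤ K) : (relSd K S enc).faces.Finite := by
  have hS' : S.faces.Finite := hK.subset hS
  have h1 : ((insert ∅ S.faces) ×ˢ (hK.toFinset.powerset : Set (Finset (Finset ℕ))) :
      Set (Finset ℕ × Finset (Finset ℕ))).Finite :=
    (hS'.insert ∅).prod (Finset.finite_toSet _)
  refine (h1.image fun q : Finset ℕ × Finset (Finset ℕ) => q.1 ∪ q.2.image enc).subset ?_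
  rintro s ⟨-, σ, C, hfl, rfl⟩
  refine ⟨(σ, C), ⟨hfl.base, ?_⟩, rfl⟩
  simp only [Finset.coe_powerset, Set.mem_preimage, Set.mem_powerset_iff]
  intro ρ hρ
  simpa using hfl.face ρ hρ

theorem le_relSd (S K : NatComplex) : S ≤ relSd K S enc := fun s hs =>
  ⟨face_nonempty hs, s, ∅, ⟨Or.inr hs, by simp, by simp, by simp, by simp⟩, by simp⟩

/-- Members of the chain strictly contain `σ` and have distinct cardinalities, so there are at most
`D - σ.card` of them. The dimension bound, and with it the contraction factor, therefore survives
iteration. -/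
theorem relSd_card_le {D : ℕ} (hS : S ≤ K) (hD : ∀ s ∈ K.faces, s.card ≤ D) :
    ∀ s ∈ (relSd K S enc).faces, s.card ≤ D := by
  rintro s ⟨-, σ, C, hfl, rfl⟩
  have hσ : σ.card ≤ D := by
    rcases hfl.base with rfl | h
    · simp
    · exact hD _ (hS h)
  have hC : C.card ≤ (Finset.Ioc σ.card D).card := by
    refine Finset.card_le_card_of_injOn Finset.card (fun ρ hρ => ?_) fun ρ hρ τ hτ hcard => ?_
    · have hlt : σ ⊂ ρ := by
        refine (hfl.base_le ρ hρ).ssubset_of_ne ?_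
        rintro rfl
        rcases hfl.base with h | h
        · exact (face_nonempty (hfl.face _ hρ)).ne_empty h
        · exact hfl.notMem _ hρ h
      exact Finset.mem_coe.2 (Finset.mem_Ioc.2 ⟨Finset.card_lt_card hlt, hD _ (hfl.face ρ hρ)⟩)
    · rcases hfl.chain ρ hρ τ hτ with h | h
      · exact Finset.eq_of_subset_of_card_le h hcard.ge
      · exact (Finset.eq_of_subset_of_card_le h hcard.le).symm
  rw [Nat.card_Ioc] at hC
  have h1 := Finset.card_union_le σ (C.image enc)
  have h2 : (C.image enc).card ≤ C.card := Finset.card_image_le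
  omega

/-! ### Decomposition of nonnegative functions along flags -/

variable (K S) in
/-- `x` is the sum of `z`, supported on `σ`, and of the multiples `c ρ` of the indicator functions
of the members `ρ` of `C`, where `(σ, C)` is a relative flag. -/
structure IsFlagSum (σ : Finset ℕ) (C : Finset (Finset ℕ)) (x z : ℕ → ℝ) (c : Finset ℕ → ℝ) :
    Prop where
  flag : IsRelFlag K S σ C
  z_pos : ∀ v, v ∈ σ ↔ 0 < z v
  z_nonneg : ∀ v, 0 ≤ z v
  c_pos : ∀ ρ, ρ ∈ C ↔ 0 < c ρ
  c_nonneg : ∀ ρ, 0 ≤ c ρ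
  eq : ∀ w, x w = z w + ∑ ρ ∈ C, if w ∈ ρ then c ρ else 0

theorem IsFlagSum.le {σ : Finset ℕ} {C : Finset (Finset ℕ)} {x z : ℕ → ℝ} {c : Finset ℕ → ℝ}
    (h : IsFlagSum K S σ C x z c) {ρ : Finset ℕ} {w : ℕ} (hw : w ∈ ρ) : c ρ ≤ x w := by
  rw [h.eq]
  by_cases hρ : ρ ∈ C
  · have h1 : (if w ∈ ρ then c ρ else 0) ≤ ∑ ρ ∈ C, if w ∈ ρ then c ρ else 0 :=
      Finset.single_le_sum (f := fun ρ => if w ∈ ρ then c ρ else 0)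
        (fun τ _ => by split_ifs; exacts [h.c_nonneg τ, le_rfl]) hρ
    rw [if_pos hw] at h1
    linarith [h.z_nonneg w]
  · have h0 : c ρ ≤ 0 := not_lt.1 fun h' => hρ ((h.c_pos ρ).2 h')
    have h1 : 0 ≤ ∑ ρ ∈ C, if w ∈ ρ then c ρ else 0 :=
      Finset.sum_nonneg fun τ _ => by split_ifs; exacts [h.c_nonneg τ, le_rfl]
    linarith [h.z_nonneg w]

theorem IsFlagSum.exists_of_pos {σ : Finset ℕ} {C : Finset (Finset ℕ)} {x z : ℕ → ℝ}
    {c : Finset ℕ → ℝ} (h : IsFlagSum K S σ C x z c) {w : ℕ} (hw : 0 < x w) :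
    w ∈ σ ∨ ∃ ρ ∈ C, w ∈ ρ := by
  by_contra! hcon
  rw [h.eq, Finset.sum_eq_zero fun ρ hρ => if_neg (hcon.2 ρ hρ), add_zero] at hw
  exact hcon.1 ((h.z_pos w).2 hw)

theorem IsFlagSum.z_le {σ : Finset ℕ} {C : Finset (Finset ℕ)} {x z : ℕ → ℝ}
    {c : Finset ℕ → ℝ} (h : IsFlagSum K S σ C x z c) (w : ℕ) : z w ≤ x w := by
  rw [h.eq]
  have h1 : 0 ≤ ∑ ρ ∈ C, if w ∈ ρ then c ρ else 0 :=
    Finset.sum_nonneg fun τ _ => by split_ifs; exacts [h.c_nonneg τ, le_rfl]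
  linarith

/-- If the support `t` of `x` is a face outside `S`, it is the largest member of the flag, and its
coefficient is the minimum of `x` on `t`. -/
theorem IsFlagSum.top {σ : Finset ℕ} {C : Finset (Finset ℕ)} {x z : ℕ → ℝ} {c : Finset ℕ → ℝ}
    (h : IsFlagSum K S σ C x z c) {t : Finset ℕ} (ht : ∀ v, v ∈ t ↔ 0 < x v) (hne : t.Nonempty)
    (hS : t ∉ S.faces) : t ∈ C ∧ ∃ w ∈ t, x w = c t := by
  have hC : C.Nonempty := by
    rw [Finset.nonempty_iff_ne_empty]
    rintro rfl
    have hsub : t ⊆ σ := fun v hv => by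
      simpa using h.exists_of_pos ((ht v).1 hv)
    rcases h.flag.base with rfl | h'
    · exact hne.ne_empty (Finset.subset_empty.1 hsub)
    · exact hS (face_subset h' hsub hne)
  obtain ⟨τ, hτ, hmax⟩ := h.flag.exists_top hC
  have hτt : τ = t := by
    refine Finset.Subset.antisymm (fun v hv => ?_) fun v hv => ?_
    · exact (ht v).2 (((h.c_pos τ).1 hτ).trans_le (h.le hv))
    · rcases h.exists_of_pos ((ht v).1 hv) with h' | ⟨ρ, hρ, h'⟩
      · exact h.flag.base_le τ hτ h'
      · exact hmax ρ hρ h'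
  subst hτt
  refine ⟨hτ, ?_⟩
  -- The rest of the flag lies in its second largest member, or in `σ` if there is none, and this is
  -- a proper part of `τ`. At a vertex outside it only `c τ` contributes.
  obtain ⟨w, hw, hwσ, hwC⟩ : ∃ w ∈ τ, w ∉ σ ∧ ∀ ρ ∈ C.erase τ, w ∉ ρ := by
    rcases (C.erase τ).eq_empty_or_nonempty with he | he
    · have : ¬ τ ⊆ σ := fun hsub => by
        rcases h.flag.base with rfl | h'
        · exact hne.ne_empty (Finset.subset_empty.1 hsub)
        · exact hS (face_subset h' hsub hne)
      obtain ⟨w, hw, hwσ⟩ := Finset.not_subset.1 this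
      exact ⟨w, hw, hwσ, by simp [he]⟩
    · obtain ⟨ρ, hρ, hmax'⟩ :=
        (h.flag.mono subset_rfl (Finset.erase_subset τ C)).exists_top he
      have hρC := Finset.mem_of_mem_erase hρ
      have : ¬ τ ⊆ ρ := fun hsub =>
        Finset.ne_of_mem_erase hρ (Finset.Subset.antisymm (hmax ρ hρC) hsub)
      obtain ⟨w, hw, hwρ⟩ := Finset.not_subset.1 this
      exact ⟨w, hw, fun hwσ => hwρ (h.flag.base_le ρ hρC hwσ), fun ρ' hρ' hw' =>
        hwρ (hmax' ρ' hρ' hw')⟩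
  refine ⟨w, hw, ?_⟩
  have hz : z w = 0 := le_antisymm (not_lt.1 fun h' => hwσ ((h.z_pos w).2 h')) (h.z_nonneg w)
  rw [h.eq, hz, zero_add, ← Finset.add_sum_erase _ _ hτ, if_pos hw,
    Finset.sum_eq_zero fun ρ hρ => if_neg (hwC ρ hρ), add_zero]

/-- Removing the largest member of the flag. -/
theorem IsFlagSum.erase {σ : Finset ℕ} {C : Finset (Finset ℕ)} {x z : ℕ → ℝ} {c : Finset ℕ → ℝ}
    (h : IsFlagSum K S σ C x z c) {t : Finset ℕ} (ht : t ∈ C) :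
    IsFlagSum K S σ (C.erase t) (fun w => x w - if w ∈ t then c t else 0) z
      (Function.update c t 0) where
  flag := h.flag.mono subset_rfl (Finset.erase_subset t C)
  z_pos := h.z_pos
  z_nonneg := h.z_nonneg
  c_pos ρ := by
    rcases eq_or_ne ρ t with rfl | hne
    · simp
    · simp [hne, h.c_pos]
  c_nonneg ρ := by
    rcases eq_or_ne ρ t with rfl | hne
    · simp
    · simp [hne, h.c_nonneg]
  eq w := by
    rw [h.eq, ← Finset.add_sum_erase _ _ ht]
    have : ∀ ρ ∈ C.erase t, (if w ∈ ρ then Function.update c t 0 ρ else 0) =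
        if w ∈ ρ then c ρ else 0 := fun ρ hρ => by
      rw [Function.update_of_ne (Finset.ne_of_mem_erase hρ)]
    rw [Finset.sum_congr rfl this]
    ring

/-- Induction on the support `t` of `x`. If `t` is empty or a face of `S`, the chain must be empty
and `z = x`. Otherwise `IsFlagSum.top` identifies the largest member as `t` and its coefficient as
the minimum of `x` on `t`; subtracting it makes the support smaller. -/
theorem IsFlagSum.unique {σ σ' : Finset ℕ} {C C' : Finset (Finset ℕ)} {x z z' : ℕ → ℝ}
    {c c' : Finset ℕ → ℝ} {t : Finset ℕ} (ht : ∀ v, v ∈ t ↔ 0 < x v)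
    (h : IsFlagSum K S σ C x z c) (h' : IsFlagSum K S σ' C' x z' c') : z = z' ∧ c = c' := by
  induction t using Finset.strongInduction generalizing x C C' c c' with
  | H t ih =>
    by_cases hS : t = ∅ ∨ t ∈ S.faces
    · have aux : ∀ {σ : Finset ℕ} {C : Finset (Finset ℕ)} {z : ℕ → ℝ} {c : Finset ℕ → ℝ},
          IsFlagSum K S σ C x z c → z = x ∧ c = 0 := by
        intro σ C z c h
        have hC : C = ∅ := by
          by_contra hne
          obtain ⟨ρ, hρ⟩ := Finset.nonempty_iff_ne_empty.2 hne
          have hsub : ρ ⊆ t := fun v hv => (ht v).2 (((h.c_pos ρ).1 hρ).trans_le (h.le hv))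
          have hne' := face_nonempty (h.flag.face ρ hρ)
          rcases hS with rfl | hS
          · exact hne'.ne_empty (Finset.subset_empty.1 hsub)
          · exact h.flag.notMem ρ hρ (face_subset hS hsub hne')
        subst hC
        refine ⟨funext fun w => by simp [h.eq w], funext fun ρ => ?_⟩
        exact le_antisymm (not_lt.1 fun h0 => by simpa using (h.c_pos ρ).2 h0) (h.c_nonneg ρ)
      rw [(aux h).1, (aux h).2, (aux h').1, (aux h').2]
      exact ⟨rfl, rfl⟩
    · push Not at hS
      obtain ⟨hne, hS⟩ := hS
      obtain ⟨htC, w, hw, hxw⟩ := h.top ht hne hS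
      obtain ⟨htC', w', hw', hxw'⟩ := h'.top ht hne hS
      have hc : c t = c' t := le_antisymm (hxw' ▸ h.le hw') (hxw ▸ h'.le hw)
      have h1 := h.erase htC
      have h1' := h'.erase htC'
      rw [← hc] at h1'
      obtain ⟨hz, hcc⟩ := ih (t.filter fun v => 0 < x v - if v ∈ t then c t else 0)
        (Finset.filter_ssubset.2 ⟨w, hw, by simp [hw, hxw]⟩)
        (fun v => by
          rw [Finset.mem_filter, and_iff_right_iff_imp]
          intro hv
          by_contra hvt
          rw [if_neg hvt, sub_zero] at hv
          exact hvt ((ht v).2 hv)) h1 h1'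
      refine ⟨hz, funext fun ρ => ?_⟩
      rcases eq_or_ne ρ t with rfl | hρ
      · exact hc
      · simpa [hρ] using congrFun hcc ρ

/-- The greedy algorithm behind `IsFlagSum.unique`: the minimum of `x` on its support is subtracted
repeatedly until the support is empty or a face of `S`. -/
theorem exists_isFlagSum {x : ℕ → ℝ} {t : Finset ℕ} (hx : ∀ v, 0 ≤ x v)
    (ht : ∀ v, v ∈ t ↔ 0 < x v) (hK : t = ∅ ∨ t ∈ K.faces) :
    ∃ σ C z c, IsFlagSum K S σ C x z c := by
  induction t using Finset.strongInduction generalizing x with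
  | H t ih =>
    by_cases hS : t = ∅ ∨ t ∈ S.faces
    · exact ⟨t, ∅, x, 0, ⟨hS, by simp, by simp, by simp, by simp⟩, ht, hx, by simp, by simp,
        by simp⟩
    · push Not at hS
      obtain ⟨hne, hS⟩ := hS
      have htK := hK.resolve_left hne.ne_empty
      obtain ⟨w, hw, hmin⟩ := t.exists_min_image x hne
      have hsub : (t.filter fun v => 0 < x v - if v ∈ t then x w else 0) ⊂ t :=
        Finset.filter_ssubset.2 ⟨w, hw, by simp [hw]⟩
      have hx' : ∀ v, 0 ≤ x v - if v ∈ t then x w else 0 := fun v => by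
        split_ifs with hv
        · exact sub_nonneg.2 (hmin v hv)
        · simpa using hx v
      have ht' : ∀ v, v ∈ (t.filter fun v => 0 < x v - if v ∈ t then x w else 0) ↔
          0 < x v - if v ∈ t then x w else 0 := fun v => by
        rw [Finset.mem_filter, and_iff_right_iff_imp]
        intro hv
        by_contra hvt
        rw [if_neg hvt, sub_zero] at hv
        exact hvt ((ht v).2 hv)
      obtain ⟨σ, C, z, c, h⟩ := ih _ hsub hx' ht' (by
        rcases Finset.eq_empty_or_nonempty
          (t.filter fun v => 0 < x v - if v ∈ t then x w else 0) with h | h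
        · exact Or.inl h
        · exact Or.inr (face_subset htK hsub.subset h))
      have hCt : ∀ ρ ∈ C, ρ ⊂ t := fun ρ hρ => by
        refine lt_of_le_of_lt (fun v hv => ?_) hsub
        exact (ht' v).2 (((h.c_pos ρ).1 hρ).trans_le (h.le hv))
      have hσt : σ ⊆ t := fun v hv =>
        hsub.subset ((ht' v).2 (((h.z_pos v).1 hv).trans_le (h.z_le v)))
      have htC : t ∉ C := fun h' => (hCt t h').ne rfl
      refine ⟨σ, insert t C, z, Function.update c t (x w), ⟨h.flag.base, ?_, ?_, ?_, ?_⟩, h.z_pos,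
        h.z_nonneg, ?_, ?_, ?_⟩
      · simpa [htK] using h.flag.face
      · simpa [hS] using h.flag.notMem
      · simpa [hσt] using h.flag.base_le
      · intro ρ hρ τ hτ
        rcases Finset.mem_insert.1 hρ with hρ | hρ <;> rcases Finset.mem_insert.1 hτ with hτ | hτ
        · exact Or.inl (hρ.trans hτ.symm).subset
        · exact Or.inr (hρ ▸ (hCt τ hτ).subset)
        · exact Or.inl (hτ ▸ (hCt ρ hρ).subset)
        · exact h.flag.chain ρ hρ τ hτ
      · intro ρ
        rcases eq_or_ne ρ t with rfl | hρ
        · simpa using (ht w).1 hw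
        · simp [hρ, h.c_pos]
      · intro ρ
        rcases eq_or_ne ρ t with rfl | hρ
        · simpa using hx w
        · simp [hρ, h.c_nonneg]
      · intro v
        have hsum : ∑ ρ ∈ C, (if v ∈ ρ then Function.update c t (x w) ρ else 0) =
            ∑ ρ ∈ C, if v ∈ ρ then c ρ else 0 := Finset.sum_congr rfl fun ρ hρ => by
          rw [Function.update_of_ne (hCt ρ hρ).ne]
        rw [Finset.sum_insert htC, hsum, Function.update_self]
        linarith [h.eq v]

end RelSd

end NatComplex

/-! ### The relative subdivision has the same realization -/

namespace NatComplex

/-- `x` lies in the closed simplex with vertex set `s`. -/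
structure InSimplex (s : Finset ℕ) (x : ℕ → ℝ) : Prop where
  nonneg : ∀ v, 0 ≤ x v
  zero : ∀ v, v ∉ s → x v = 0
  sum : ∑ v ∈ s, x v = 1

theorem mem_realization_iff {K : NatComplex} {x : ℕ → ℝ} :
    x ∈ realization K ↔ ∃ s ∈ K.faces, InSimplex s x :=
  ⟨fun ⟨s, hs, h1, h2, h3⟩ => ⟨s, hs, h1, h2, h3⟩, fun ⟨s, hs, h1, h2, h3⟩ => ⟨s, hs, h1, h2, h3⟩⟩

theorem InSimplex.mem_realization {K : NatComplex} {x : ℕ → ℝ} {s : Finset ℕ} (h : InSimplex s x)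
    (hs : s ∈ K.faces) : x ∈ realization K := mem_realization_iff.2 ⟨s, hs, h⟩

theorem InSimplex.single {s : Finset ℕ} {v : ℕ} (hv : v ∈ s) :
    InSimplex s (Pi.single v 1 : ℕ → ℝ) where
  nonneg u := by
    by_cases h : u = v
    · subst h; simp
    · simp [h]
  zero u hu := Pi.single_eq_of_ne (fun h : u = v => hu (h ▸ hv)) _
  sum := by simp [hv]

theorem InSimplex.le_one {s : Finset ℕ} {x : ℕ → ℝ} (h : InSimplex s x) (v : ℕ) : x v ≤ 1 := by
  by_cases hv : v ∈ s
  · rw [← h.sum]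
    exact Finset.single_le_sum (fun u _ => h.nonneg u) hv
  · rw [h.zero v hv]
    exact zero_le_one

theorem InSimplex.combo {s t : Finset ℕ} {y : ℕ → ℝ} {p : ℕ → ℕ → ℝ} (hy : InSimplex s y)
    (hp : ∀ v ∈ s, InSimplex t (p v)) : InSimplex t (combo p y) where
  nonneg w := by
    rw [combo_eq_sum hy.zero]
    exact Finset.sum_nonneg fun v hv => mul_nonneg (hy.nonneg v) ((hp v hv).nonneg w)
  zero w hw := by
    rw [combo_eq_sum hy.zero]
    exact Finset.sum_eq_zero fun v hv => by rw [(hp v hv).zero w hw, mul_zero]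
  sum := by
    simp only [combo_eq_sum hy.zero]
    rw [Finset.sum_comm, ← hy.sum]
    refine Finset.sum_congr rfl fun v hv => ?_
    rw [← Finset.mul_sum, (hp v hv).sum, mul_one]

theorem InSimplex.average {ρ t : Finset ℕ} (hρ : ρ.Nonempty) {p : ℕ → ℕ → ℝ}
    (hp : ∀ v ∈ ρ, InSimplex t (p v)) : InSimplex t fun w => average ρ fun u => p u w where
  nonneg w := average_nonneg fun u hu => (hp u hu).nonneg w
  zero w hw := average_eq_zero fun u hu => (hp u hu).zero w hw
  sum := by
    have h1 : (ρ.card : ℝ) ≠ 0 := by exact_mod_cast hρ.card_ne_zero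
    simp only [NatComplex.average]
    rw [← Finset.mul_sum, Finset.sum_comm, Finset.sum_congr rfl fun u hu => (hp u hu).sum]
    simp [h1]

section

variable {K S : NatComplex} {enc : Finset ℕ → ℕ}

open Classical in
variable (S enc) in
/-- The positions of the vertices of the relative subdivision: the vertices of `S` stay in place,
and the vertex `enc ρ` is placed at the barycenter of `ρ`. -/
noncomputable def relSdPoint (p : ℕ → ℕ → ℝ) (v : ℕ) : ℕ → ℝ :=
  if {v} ∈ S.faces then p v else fun w => average (Function.invFun enc v) fun u => p u w

theorem relSdPoint_of_mem (p : ℕ → ℕ → ℝ) {v : ℕ} (hv : {v} ∈ S.faces) :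
    relSdPoint S enc p v = p v := if_pos hv

theorem relSdPoint_enc (henc : enc.Injective) (hS : ∀ ρ, {enc ρ} ∉ S.faces) (p : ℕ → ℕ → ℝ)
    (ρ : Finset ℕ) : relSdPoint S enc p (enc ρ) = fun w => average ρ fun u => p u w := by
  rw [relSdPoint, if_neg (hS ρ), Function.leftInverse_invFun henc]

theorem IsRelFlag.singleton_mem {σ : Finset ℕ} {C : Finset (Finset ℕ)} (h : IsRelFlag K S σ C)
    {v : ℕ} (hv : v ∈ σ) : {v} ∈ S.faces := by
  rcases h.base with rfl | h'
  · simp at hv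
  · exact singleton_face h' hv

theorem IsRelFlag.disjoint {σ : Finset ℕ} {C : Finset (Finset ℕ)} (h : IsRelFlag K S σ C)
    (hS : ∀ ρ, {enc ρ} ∉ S.faces) : Disjoint σ (C.image enc) := by
  rw [Finset.disjoint_left]
  intro v hv hv'
  obtain ⟨ρ, -, rfl⟩ := Finset.mem_image.1 hv'
  exact hS ρ (h.singleton_mem hv)

theorem IsRelFlag.sum_union {σ : Finset ℕ} {C : Finset (Finset ℕ)} (h : IsRelFlag K S σ C)
    (henc : enc.Injective) (hS : ∀ ρ, {enc ρ} ∉ S.faces) (g : ℕ → ℝ) :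
    ∑ v ∈ σ ∪ C.image enc, g v = ∑ v ∈ σ, g v + ∑ ρ ∈ C, g (enc ρ) := by
  rw [Finset.sum_union (h.disjoint hS), Finset.sum_image fun _ _ _ _ h' => henc h']

theorem average_single {ρ : Finset ℕ} (w : ℕ) :
    average ρ (fun u => (Pi.single u 1 : ℕ → ℝ) w) = if w ∈ ρ then (ρ.card : ℝ)⁻¹ else 0 := by
  rw [average]
  simp [Pi.single_apply]

/-- The position of a point of the relative subdivision in `K`. -/
theorem combo_relSdPoint_single {σ : Finset ℕ} {C : Finset (Finset ℕ)} (h : IsRelFlag K S σ C)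
    (henc : enc.Injective) (hS : ∀ ρ, {enc ρ} ∉ S.faces) {y : ℕ → ℝ}
    (hy : ∀ v, v ∉ σ ∪ C.image enc → y v = 0) (w : ℕ) :
    combo (relSdPoint S enc fun v => Pi.single v 1) y w =
      (if w ∈ σ then y w else 0) +
        ∑ ρ ∈ C, if w ∈ ρ then y (enc ρ) * (ρ.card : ℝ)⁻¹ else 0 := by
  rw [combo_eq_sum hy, h.sum_union henc hS]
  congr 1
  · rw [Finset.sum_congr rfl fun v hv => by
      rw [relSdPoint_of_mem _ (h.singleton_mem hv), Pi.single_apply, mul_ite, mul_one, mul_zero]]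
    rw [Finset.sum_ite_eq]
  · refine Finset.sum_congr rfl fun ρ _ => ?_
    rw [relSdPoint_enc henc hS]
    beta_reduce
    rw [average_single, mul_ite, mul_zero]

/-- All new positions are old positions at vertices of the top member `τ` of the flag (of `σ` if the
chain is empty) or averages of such. The set `T` is left free so that the carrier can be taken in
`K` or in a complex that `K` already subdivides. -/
theorem relSdPoint_inSimplex (henc : enc.Injective) (hS : ∀ ρ, {enc ρ} ∉ S.faces)
    (hSK : S ≤ K) {p : ℕ → ℕ → ℝ}
    {s : Finset ℕ} (hs : s ∈ (relSd K S enc).faces) :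
    ∃ τ ∈ K.faces, ∀ T, (∀ v ∈ τ, InSimplex T (p v)) →
      ∀ v ∈ s, InSimplex T (relSdPoint S enc p v) := by
  obtain ⟨hne, σ, C, hfl, rfl⟩ := hs
  rcases C.eq_empty_or_nonempty with rfl | hC
  · simp only [Finset.image_empty, Finset.union_empty] at hne ⊢
    have hσ := hfl.base.resolve_left hne.ne_empty
    refine ⟨σ, hSK hσ, fun T hT v hv => ?_⟩
    rw [relSdPoint_of_mem _ (hfl.singleton_mem hv)]
    exact hT v hv
  · obtain ⟨τ, hτ, hmax⟩ := hfl.exists_top hC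
    refine ⟨τ, hfl.face τ hτ, fun T hT v hv => ?_⟩
    rcases Finset.mem_union.1 hv with hv | hv
    · rw [relSdPoint_of_mem _ (hfl.singleton_mem hv)]
      exact hT v (hfl.base_le τ hτ hv)
    · obtain ⟨ρ, hρ, rfl⟩ := Finset.mem_image.1 hv
      rw [relSdPoint_enc henc hS]
      exact InSimplex.average (face_nonempty (hfl.face ρ hρ)) fun u hu => hT u (hmax ρ hρ hu)

open Classical in
variable (S) in
/-- The coefficients of `y` at the vertices of `S`. -/
noncomputable def flagBase (y : ℕ → ℝ) (v : ℕ) : ℝ := if {v} ∈ S.faces then y v else 0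

open Classical in
variable (K S enc) in
/-- The normalized coefficients of `y` at the barycenters. -/
noncomputable def flagCoeff (y : ℕ → ℝ) (ρ : Finset ℕ) : ℝ :=
  if ρ ∈ K.faces ∧ ρ ∉ S.faces then y (enc ρ) * (ρ.card : ℝ)⁻¹ else 0

/-- A barycenter spreads its coefficient evenly over its face, so the barycentric coordinates in the
subdivision are, up to the factors `ρ.card`, the coefficients of a flag decomposition. -/
theorem isFlagSum_combo (henc : enc.Injective) (hS : ∀ ρ, {enc ρ} ∉ S.faces) {y : ℕ → ℝ}
    (hy : y ∈ realization (relSd K S enc)) :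
    ∃ σ C, IsFlagSum K S σ C (combo (relSdPoint S enc fun v => Pi.single v 1) y)
      (flagBase S y) (flagCoeff K S enc y) ∧ ∀ v, v ∈ σ ∪ C.image enc ↔ 0 < y v := by
  obtain ⟨t, ⟨-, σ, C, hfl, rfl⟩, hpos, h0, -⟩ := exists_support hy
  have hbase : ∀ v, v ∈ σ ↔ 0 < flagBase S y v := by
    intro v
    rw [flagBase]
    constructor
    · intro hv
      rw [if_pos (hfl.singleton_mem hv)]
      exact (hpos v).1 (Finset.mem_union_left _ hv)
    · split_ifs with hv
      · intro h
        rcases Finset.mem_union.1 ((hpos v).2 h) with h' | h'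
        · exact h'
        · obtain ⟨ρ, -, rfl⟩ := Finset.mem_image.1 h'
          exact absurd hv (hS ρ)
      · exact fun h => absurd h (lt_irrefl _)
  have hcoeff : ∀ ρ, ρ ∈ C ↔ 0 < flagCoeff K S enc y ρ := by
    intro ρ
    rw [flagCoeff]
    constructor
    · intro hρ
      rw [if_pos ⟨hfl.face ρ hρ, hfl.notMem ρ hρ⟩]
      have h1 : (0 : ℝ) < ρ.card := by
        exact_mod_cast Finset.card_pos.2 (face_nonempty (hfl.face ρ hρ))
      exact mul_pos ((hpos _).1 (Finset.mem_union_right _ (Finset.mem_image_of_mem enc hρ)))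
        (inv_pos.2 h1)
    · split_ifs with hρ
      · intro h
        have h1 : 0 < y (enc ρ) := pos_of_mul_pos_left h (by positivity)
        rcases Finset.mem_union.1 ((hpos _).2 h1) with h' | h'
        · exact absurd (hfl.singleton_mem h') (hS ρ)
        · obtain ⟨τ, hτ, he⟩ := Finset.mem_image.1 h'
          exact henc he ▸ hτ
      · exact fun h => absurd h (lt_irrefl _)
  refine ⟨σ, C, ⟨hfl, hbase, fun v => ?_, hcoeff, fun ρ => ?_, fun w => ?_⟩, hpos⟩
  · rw [flagBase]
    split_ifs
    exacts [h0 v, le_rfl]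
  · rw [flagCoeff]
    split_ifs
    exacts [mul_nonneg (h0 _) (by positivity), le_rfl]
  · rw [combo_relSdPoint_single hfl henc hS fun v hv =>
      le_antisymm (not_lt.1 fun h => hv ((hpos v).2 h)) (h0 v)]
    congr 1
    · by_cases hw : w ∈ σ
      · rw [if_pos hw, flagBase, if_pos (hfl.singleton_mem hw)]
      · rw [if_neg hw]
        refine (le_antisymm (not_lt.1 fun h => hw ((hbase w).2 h)) ?_).symm
        rw [flagBase]
        split_ifs
        exacts [h0 w, le_rfl]
    · refine Finset.sum_congr rfl fun ρ hρ => ?_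
      rw [flagCoeff, if_pos (c := ρ ∈ K.faces ∧ ρ ∉ S.faces) ⟨hfl.face ρ hρ, hfl.notMem ρ hρ⟩]

/-- Injectivity is uniqueness of the flag decomposition and surjectivity is its existence. -/
theorem relSd_bijOn (henc : enc.Injective) (hS : ∀ ρ, {enc ρ} ∉ S.faces) (hSK : S ≤ K) :
    BijOn (combo (relSdPoint S enc fun v => Pi.single v 1)) (realization (relSd K S enc))
      (realization K) := by
  have hmaps : MapsTo (combo (relSdPoint S enc fun v => Pi.single v 1))
      (realization (relSd K S enc)) (realization K) := by
    intro y hy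
    obtain ⟨s, hs, hys⟩ := mem_realization_iff.1 hy
    obtain ⟨τ, hτ, hT⟩ := relSdPoint_inSimplex (p := fun v => Pi.single v 1) henc hS hSK hs
    exact (hys.combo (hT τ fun v hv => InSimplex.single hv)).mem_realization hτ
  refine ⟨hmaps, ?_, ?_⟩
  · intro y hy y' hy' heq
    obtain ⟨σ, C, hsum, hpos⟩ := isFlagSum_combo henc hS hy
    obtain ⟨σ', C', hsum', hpos'⟩ := isFlagSum_combo henc hS hy'
    obtain ⟨t, -, ht, -⟩ := exists_support (hmaps hy)
    rw [← heq] at hsum'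
    obtain ⟨hz, hc⟩ := hsum.unique ht hsum'
    have hσ : σ = σ' := by
      ext v
      rw [hsum.z_pos, hsum'.z_pos, hz]
    have hC : C = C' := by
      ext v
      rw [hsum.c_pos, hsum'.c_pos, hc]
    subst hσ hC
    ext v
    by_cases hv : v ∈ σ ∪ C.image enc
    · rcases Finset.mem_union.1 hv with hv | hv
      · have h1 := congrFun hz v
        simpa only [flagBase, if_pos (hsum.flag.singleton_mem hv)] using h1
      · obtain ⟨ρ, hρ, rfl⟩ := Finset.mem_image.1 hv
        have h1 := congrFun hc ρ
        have h2 : (ρ.card : ℝ)⁻¹ ≠ 0 := inv_ne_zero (by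
          exact_mod_cast (face_nonempty (hsum.flag.face ρ hρ)).card_ne_zero)
        simp only [flagCoeff, if_pos (And.intro (hsum.flag.face ρ hρ) (hsum.flag.notMem ρ hρ))]
          at h1
        exact mul_right_cancel₀ h2 h1
    · rw [le_antisymm (not_lt.1 fun h => hv ((hpos v).2 h)) (realization_nonneg hy v),
        le_antisymm (not_lt.1 fun h => hv ((hpos' v).2 h)) (realization_nonneg hy' v)]
  · intro x hx
    obtain ⟨t, ht, htpos, h0, hsum⟩ := exists_support hx
    obtain ⟨σ, C, z, c, h⟩ := exists_isFlagSum (S := S) h0 htpos (Or.inr ht)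
    have hz0 : ∀ v, v ∉ σ → z v = 0 := fun v hv =>
      le_antisymm (not_lt.1 fun h' => hv ((h.z_pos v).2 h')) (h.z_nonneg v)
    -- The factor `ρ.card` undoes the averaging at the barycenter of `ρ`.
    let y : ℕ → ℝ := fun v => z v + ∑ ρ ∈ C, if v = enc ρ then c ρ * ρ.card else 0
    have hyσ : ∀ v, {v} ∈ S.faces → y v = z v := by
      intro v hv
      simp only [y]
      rw [Finset.sum_eq_zero fun ρ _ => if_neg ?_, add_zero]
      rintro rfl
      exact hS ρ hv
    have hyC : ∀ ρ ∈ C, y (enc ρ) = c ρ * ρ.card := by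
      intro ρ hρ
      simp only [y]
      rw [hz0 _ fun h' => hS ρ (h.flag.singleton_mem h'), zero_add, Finset.sum_eq_single ρ,
        if_pos rfl]
      · exact fun τ _ hτ => if_neg fun h' => hτ (henc h').symm
      · exact fun h' => absurd hρ h'
    have hy0 : ∀ v, v ∉ σ ∪ C.image enc → y v = 0 := by
      intro v hv
      simp only [Finset.mem_union, not_or] at hv
      simp only [y]
      rw [hz0 v hv.1, zero_add]
      refine Finset.sum_eq_zero fun ρ hρ => if_neg ?_
      rintro rfl
      exact hv.2 (Finset.mem_image_of_mem enc hρ)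
    have hynonneg : ∀ v, 0 ≤ y v := fun v => add_nonneg (h.z_nonneg v)
      (Finset.sum_nonneg fun ρ _ => by
        split_ifs
        exacts [mul_nonneg (h.c_nonneg ρ) (by positivity), le_rfl])
    have hσt : σ ⊆ t := fun v hv => (htpos v).2 (((h.z_pos v).1 hv).trans_le (h.z_le v))
    have hCt : ∀ ρ ∈ C, ρ ⊆ t := fun ρ hρ v hv =>
      (htpos v).2 (((h.c_pos ρ).1 hρ).trans_le (h.le hv))
    have hysum : ∑ v ∈ σ ∪ C.image enc, y v = 1 := by
      rw [h.flag.sum_union henc hS, ← hsum,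
        Finset.sum_congr rfl fun v hv => hyσ v (h.flag.singleton_mem hv),
        Finset.sum_congr rfl hyC, Finset.sum_congr rfl fun w (_ : w ∈ t) => h.eq w,
        Finset.sum_add_distrib, Finset.sum_subset hσt fun v _ hv => hz0 v hv, Finset.sum_comm]
      congr 1
      refine Finset.sum_congr rfl fun ρ hρ => ?_
      rw [← Finset.sum_filter, Finset.filter_mem_eq_inter, Finset.inter_eq_right.2 (hCt ρ hρ),
        Finset.sum_const, nsmul_eq_mul, mul_comm]
    have hne : (σ ∪ C.image enc).Nonempty := by
      rw [Finset.nonempty_iff_ne_empty]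
      intro he
      rw [he] at hysum
      simp at hysum
    refine ⟨y, InSimplex.mem_realization ⟨hynonneg, hy0, hysum⟩ ⟨hne, σ, C, h.flag, rfl⟩, ?_⟩
    ext w
    rw [combo_relSdPoint_single h.flag henc hS hy0, h.eq]
    congr 1
    · split_ifs with hw
      · exact hyσ w (h.flag.singleton_mem hw)
      · exact (hz0 w hw).symm
    · refine Finset.sum_congr rfl fun ρ hρ => ?_
      have h2 : (ρ.card : ℝ) ≠ 0 := by
        exact_mod_cast (face_nonempty (h.flag.face ρ hρ)).card_ne_zero
      rw [hyC ρ hρ, mul_inv_cancel_right₀ h2]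

end

/-! ### Iterated relative subdivisions -/

/-- `K`, with its vertices placed at the points `p v` of the realization of `K₀`, is a subdivision
of `K₀` that contains the subcomplex `S` of `K₀` unchanged. -/
structure IsSubdivision (K₀ S K : NatComplex) (p : ℕ → ℕ → ℝ) : Prop where
  finite : K.faces.Finite
  le : S ≤ K
  point_eq : ∀ v, {v} ∈ S.faces → p v = Pi.single v 1
  carrier : ∀ s ∈ K.faces, ∃ τ ∈ K₀.faces, ∀ v ∈ s, InSimplex τ (p v)
  bijOn : BijOn (combo p) (realization K) (realization K₀)

/-- On the faces of `K` that meet `S`, the coordinate `a` of the points `p v` is at most `α`. -/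
def TouchingLe (S K : NatComplex) (p : ℕ → ℕ → ℝ) (a : ℕ) (α : ℝ) : Prop :=
  ∀ s ∈ K.faces, (∃ v ∈ s, {v} ∈ S.faces) → ∀ v ∈ s, p v a ≤ α

/-- Each face of `K` has all its vertices where the coordinate `a` is at most `β`, or the
coordinates of its vertices differ by at most `ε`. -/
def IsFine (K : NatComplex) (p : ℕ → ℕ → ℝ) (a : ℕ) (β ε : ℝ) : Prop :=
  ∀ s ∈ K.faces, (∀ v ∈ s, p v a ≤ β) ∨ ∀ u ∈ s, ∀ v ∈ s, ∀ w, |p u w - p v w| ≤ ε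

theorem isSubdivision_refl {K S : NatComplex} (hK : K.faces.Finite) (hS : S ≤ K) :
    IsSubdivision K S K fun v => Pi.single v 1 where
  finite := hK
  le := hS
  point_eq _ _ := rfl
  carrier s hs := ⟨s, hs, fun v hv => InSimplex.single hv⟩
  bijOn := (bijOn_id _).congr fun y hy => by
    obtain ⟨s, -, h⟩ := mem_realization_iff.1 hy
    exact (combo_single h.zero).symm

/-- One relative barycentric subdivision. In a new face that meets `S`, each barycenter belongs to
an old face that meets `S`; a vertex of `S` has coordinate 0 at `a`, so averaging contracts the
bound on that coordinate. A new face that misses `S` consists of barycenters of a chain, and the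
usual mesh estimate applies. The two mechanisms give the second and the third clause. -/
theorem IsSubdivision.step {K₀ S K : NatComplex} {p : ℕ → ℕ → ℝ} (h : IsSubdivision K₀ S K p)
    {D : ℕ} (hD : ∀ s ∈ K.faces, s.card ≤ D) :
    ∃ K' p', IsSubdivision K₀ S K' p' ∧ (∀ s ∈ K'.faces, s.card ≤ D) ∧
      ∀ a, {a} ∉ S.faces →
        (∀ α, TouchingLe S K p a α → TouchingLe S K' p' a α) ∧
        (∀ α, 0 ≤ α → TouchingLe S K p a α → TouchingLe S K' p' a ((1 - (D : ℝ)⁻¹) * α)) ∧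
        ∀ β ε, 0 ≤ ε → TouchingLe S K p a β → IsFine K p a β ε →
          IsFine K' p' a β ((1 - (D : ℝ)⁻¹) * ε) := by
  obtain ⟨M, hM⟩ := exists_vertex_bound h.finite
  -- The shift by `M` keeps the new vertices apart from those of `K`, hence from those of `S`.
  let enc : Finset ℕ → ℕ := fun ρ => M + Encodable.encode ρ
  have henc : enc.Injective := fun ρ τ hρτ => Encodable.encode_injective (Nat.add_left_cancel hρτ)
  have hS : ∀ ρ, {enc ρ} ∉ S.faces := fun ρ hρ =>
    absurd (hM _ (h.le hρ) _ (Finset.mem_singleton_self _)) (by simp [enc])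
  have hface : ∀ {σ : Finset ℕ} {C : Finset (Finset ℕ)}, IsRelFlag K S σ C →
      (∃ v ∈ σ ∪ C.image enc, {v} ∈ S.faces) → σ ∈ S.faces := by
    rintro σ C hfl ⟨v, hv, hvS⟩
    refine hfl.base.resolve_left ?_
    rintro rfl
    rw [Finset.empty_union] at hv
    obtain ⟨ρ, -, rfl⟩ := Finset.mem_image.1 hv
    exact hS ρ hvS
  have htouch : ∀ a, {a} ∉ S.faces → ∀ α α', TouchingLe S K p a α →
      ((∃ s, s ∈ S.faces) → 0 ≤ α → 0 ≤ α') →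
      (∀ ρ ∈ K.faces, (∃ v ∈ ρ, {v} ∈ S.faces) → average ρ (fun u => p u a) ≤ α') →
      TouchingLe S (relSd K S enc) (relSdPoint S enc p) a α' := by
    rintro a ha α α' hα hαα' hav s ⟨-, σ, C, hfl, rfl⟩ htch v hv
    have hσ := hface hfl htch
    rcases Finset.mem_union.1 hv with hv | hv
    · rw [relSdPoint_of_mem _ (hfl.singleton_mem hv)]
      have hp := h.point_eq v (hfl.singleton_mem hv)
      have hva : a ≠ v := by
        rintro rfl
        exact ha (hfl.singleton_mem hv)
      have h0 : p v a = 0 := by rw [hp, Pi.single_eq_of_ne hva]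
      have := hα σ (h.le hσ) ⟨v, hv, hfl.singleton_mem hv⟩ v hv
      rw [h0] at this ⊢
      exact hαα' ⟨σ, hσ⟩ this
    · obtain ⟨ρ, hρ, rfl⟩ := Finset.mem_image.1 hv
      rw [relSdPoint_enc henc hS]
      obtain ⟨u, hu⟩ := face_nonempty hσ
      exact hav ρ (hfl.face ρ hρ) ⟨u, hfl.base_le ρ hρ hu, singleton_face hσ hu⟩
  have htouch' : ∀ a, {a} ∉ S.faces → ∀ α, TouchingLe S K p a α →
      TouchingLe S (relSd K S enc) (relSdPoint S enc p) a α := fun a ha α hα =>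
    htouch a ha α α hα (fun _ h' => h') fun ρ hρ htch =>
      average_le (face_nonempty hρ) (hα ρ hρ htch)
  refine ⟨relSd K S enc, relSdPoint S enc p, ⟨relSd_finite h.finite h.le, le_relSd S K, ?_, ?_, ?_⟩,
    relSd_card_le h.le hD, fun a ha => ⟨htouch' a ha, ?_, ?_⟩⟩
  · intro v hv
    rw [relSdPoint_of_mem _ hv, h.point_eq v hv]
  · intro s hs
    obtain ⟨τ, hτ, hT⟩ := relSdPoint_inSimplex (p := p) henc hS h.le hs
    obtain ⟨τ₀, hτ₀, hc⟩ := h.carrier τ hτ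
    exact ⟨τ₀, hτ₀, hT τ₀ hc⟩
  · refine (h.bijOn.comp (relSd_bijOn henc hS h.le)).congr fun y hy => ?_
    obtain ⟨s, hs, hys⟩ := mem_realization_iff.1 hy
    obtain ⟨τ, hτ, hT⟩ := relSdPoint_inSimplex (p := fun v => Pi.single v 1) henc hS h.le hs
    have hT' := hT τ fun v hv => InSimplex.single hv
    rw [Function.comp_apply, combo_combo hys.zero fun v hv => (hT' v hv).zero]
    ext w
    rw [combo_eq_sum hys.zero, combo_eq_sum hys.zero]
    refine Finset.sum_congr rfl fun v hv => ?_
    congr 1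
    obtain ⟨-, σ, C, hfl, rfl⟩ := hs
    rcases Finset.mem_union.1 hv with hv | hv
    · rw [relSdPoint_of_mem _ (hfl.singleton_mem hv), relSdPoint_of_mem _ (hfl.singleton_mem hv),
        combo_eq_sum (s := {v}) fun u hu => Pi.single_eq_of_ne (by simpa using hu) _]
      simp
    · obtain ⟨ρ, hρ, rfl⟩ := Finset.mem_image.1 hv
      rw [relSdPoint_enc henc hS, relSdPoint_enc henc hS, combo_eq_sum (s := ρ) fun u hu => by
        rw [average_single, if_neg hu]]
      change _ = (ρ.card : ℝ)⁻¹ * ∑ u ∈ ρ, p u w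
      rw [Finset.mul_sum]
      refine Finset.sum_congr rfl fun u hu => ?_
      rw [average_single, if_pos hu]
  · intro α hα0 hα
    refine htouch a ha α _ hα (fun ⟨s, hs⟩ _ => mul_nonneg (sub_nonneg.2 ?_) hα0)
      fun ρ hρ htch => ?_
    · have : 1 ≤ D := (Finset.card_pos.2 (face_nonempty (h.le hs))).trans_le (hD s (h.le hs))
      exact inv_le_one_of_one_le₀ (by exact_mod_cast this)
    · obtain ⟨v, hv, hvS⟩ := id htch
      refine average_le_of_zero (hD ρ hρ) hα0 (hα ρ hρ htch) hv ?_
      rw [h.point_eq v hvS, Pi.single_eq_of_ne]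
      rintro rfl
      exact ha hvS
  · intro β ε hε hβ hfine s hs
    obtain ⟨-, σ, C, hfl, rfl⟩ := id hs
    -- Faces that meet `S` need not shrink; they go into the first alternative of `IsFine`, where
    -- the bound `β` is preserved.
    by_cases hσ : ∃ v ∈ σ ∪ C.image enc, {v} ∈ S.faces
    · exact Or.inl (htouch' a ha β hβ _ hs hσ)
    · have hσ0 : σ = ∅ := by
        by_contra hne
        obtain ⟨v, hv⟩ := Finset.nonempty_iff_ne_empty.2 hne
        exact hσ ⟨v, Finset.mem_union_left _ hv, hfl.singleton_mem hv⟩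
      subst hσ0
      rw [Finset.empty_union]
      rcases C.eq_empty_or_nonempty with rfl | hC
      · exact Or.inl (by simp)
      · obtain ⟨τ, hτ, hmax⟩ := hfl.exists_top hC
        rcases hfine τ (hfl.face τ hτ) with h' | h'
        · left
          intro v hv
          obtain ⟨ρ, hρ, rfl⟩ := Finset.mem_image.1 hv
          rw [relSdPoint_enc henc hS]
          exact average_le (face_nonempty (hfl.face ρ hρ)) fun u hu => h' u (hmax ρ hρ hu)
        · right
          have key : ∀ ρ ∈ C, ∀ ρ' ∈ C, ρ ⊆ ρ' → ∀ w,
              |average ρ (fun u => p u w) - average ρ' (fun u => p u w)| ≤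
                (1 - (D : ℝ)⁻¹) * ε := fun ρ hρ ρ' hρ' hsub w =>
            abs_average_sub_average_le (face_nonempty (hfl.face ρ hρ)) hsub
              (hD ρ' (hfl.face ρ' hρ')) hε fun u hu v hv =>
                h' u (hmax ρ' hρ' hu) v (hmax ρ' hρ' hv) w
          intro u hu v hv w
          obtain ⟨ρ, hρ, rfl⟩ := Finset.mem_image.1 hu
          obtain ⟨ρ', hρ', rfl⟩ := Finset.mem_image.1 hv
          rw [relSdPoint_enc henc hS, relSdPoint_enc henc hS]
          rcases hfl.chain ρ hρ ρ' hρ' with h1 | h1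
          · exact key ρ hρ ρ' hρ' h1 w
          · rw [abs_sub_comm]
            exact key ρ' hρ' ρ hρ h1 w

/-- Arbitrarily fine subdivisions relative to a subcomplex `S`, away from `S`. -/
theorem exists_fine_subdivision {K S : NatComplex} (hK : K.faces.Finite) (hS : S ≤ K) {a : ℕ}
    (ha : {a} ∉ S.faces) {β ε : ℝ} (hβ : 0 < β ∨ ∀ s, s ∉ S.faces) (hε : 0 < ε) :
    ∃ K' p, IsSubdivision K S K' p ∧ IsFine K' p a β ε := by
  obtain ⟨D, hD1, hD⟩ : ∃ D : ℕ, 1 ≤ D ∧ ∀ s ∈ K.faces, s.card ≤ D := by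
    obtain ⟨M, hM⟩ := exists_vertex_bound hK
    refine ⟨M + 1, by omega, fun s hs => ?_⟩
    have : s ⊆ Finset.range M := fun v hv => Finset.mem_range.2 (hM s hs v hv)
    have := Finset.card_le_card this
    rw [Finset.card_range] at this
    omega
  set q : ℝ := 1 - (D : ℝ)⁻¹ with hq
  have hDpos : (0 : ℝ) < (D : ℝ)⁻¹ := inv_pos.2 (by exact_mod_cast hD1)
  have hq0 : 0 ≤ q := sub_nonneg.2 (inv_le_one_of_one_le₀ (by exact_mod_cast hD1))
  have hq1 : q < 1 := by linarith
  have le_one : ∀ {K' : NatComplex} {p : ℕ → ℕ → ℝ}, IsSubdivision K S K' p →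
      ∀ s ∈ K'.faces, ∀ v ∈ s, ∀ w, 0 ≤ p v w ∧ p v w ≤ 1 := fun h s hs v hv w => by
    obtain ⟨τ, -, hτ⟩ := h.carrier s hs
    exact ⟨(hτ v hv).nonneg w, (hτ v hv).le_one w⟩
  -- The faces that meet `S` are first pushed towards coordinate 0 at `a`; only once they are below
  -- `β` does the mesh of the others start to count.
  have phase1 : ∀ k : ℕ, ∃ K' p, IsSubdivision K S K' p ∧ (∀ s ∈ K'.faces, s.card ≤ D) ∧
      TouchingLe S K' p a (q ^ k) := by
    intro k
    induction k with
    | zero =>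
      refine ⟨K, _, isSubdivision_refl hK hS, hD, fun s hs _ v hv => ?_⟩
      rw [pow_zero]
      exact (le_one (isSubdivision_refl hK hS) s hs v hv a).2
    | succ k ih =>
      obtain ⟨K', p, h, hD', ht⟩ := ih
      obtain ⟨K'', p', h', hD'', hstep⟩ := h.step hD'
      refine ⟨K'', p', h', hD'', ?_⟩
      rw [pow_succ, mul_comm]
      exact (hstep a ha).2.1 _ (pow_nonneg hq0 k) ht
  have base : ∃ K' p, IsSubdivision K S K' p ∧ (∀ s ∈ K'.faces, s.card ≤ D) ∧
      TouchingLe S K' p a β := by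
    rcases hβ with hβ | hβ
    · obtain ⟨k, hk⟩ := exists_pow_lt_of_lt_one hβ hq1
      obtain ⟨K', p, h, hD', ht⟩ := phase1 k
      exact ⟨K', p, h, hD', fun s hs htch v hv => (ht s hs htch v hv).trans hk.le⟩
    · exact ⟨K, _, isSubdivision_refl hK hS, hD, fun s _ ⟨v, _, hv⟩ => absurd hv (hβ _)⟩
  -- The start `k = 0` is free, since coordinates lie in `[0, 1]` and so differ by at most 1.
  have phase2 : ∀ k : ℕ, ∃ K' p, IsSubdivision K S K' p ∧ (∀ s ∈ K'.faces, s.card ≤ D) ∧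
      TouchingLe S K' p a β ∧ IsFine K' p a β (q ^ k) := by
    intro k
    induction k with
    | zero =>
      obtain ⟨K', p, h, hD', ht⟩ := base
      refine ⟨K', p, h, hD', ht, fun s hs => Or.inr fun u hu v hv w => ?_⟩
      rw [pow_zero, abs_le]
      have h1 := le_one h s hs u hu w
      have h2 := le_one h s hs v hv w
      constructor <;> linarith
    | succ k ih =>
      obtain ⟨K', p, h, hD', ht, hf⟩ := ih
      obtain ⟨K'', p', h', hD'', hstep⟩ := h.step hD'
      refine ⟨K'', p', h', hD'', (hstep a ha).1 _ ht, ?_⟩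
      rw [pow_succ, mul_comm]
      exact (hstep a ha).2.2 _ _ (pow_nonneg hq0 k) ht hf
  obtain ⟨k, hk⟩ := exists_pow_lt_of_lt_one hε hq1
  obtain ⟨K', p, h, -, -, hf⟩ := phase2 k
  refine ⟨K', p, h, fun s hs => (hf s hs).imp_right fun h' u hu v hv w =>
    (h' u hu v hv w).trans hk.le⟩

end NatComplex

open NatComplex

/-! ### Triangulations obtained by subdivision -/

namespace Triangulation

variable {Y : Type*} [TopologicalSpace Y]

/-- The point of `Y` that is the vertex `v` of a triangulation. -/
noncomputable def vertex (T : Triangulation Y) {v : ℕ} (hv : {v} ∈ T.complex.faces) : Y :=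
  T.homeo ⟨Pi.single v 1, vertex_mem_realization hv⟩

theorem homeo_symm_vertex (T : Triangulation Y) {v : ℕ} (hv : {v} ∈ T.complex.faces) :
    (T.homeo.symm (T.vertex hv)).1 = Pi.single v 1 := by
  rw [vertex, Homeomorph.symm_apply_apply]

/-- A subdivision of the complex of a triangulation of `Y` is a triangulation of `Y`. -/
noncomputable def subdivide [T2Space Y] {K₀ S K : NatComplex} {p : ℕ → ℕ → ℝ}
    (e : realization K₀ ≃ₜ Y) (h : IsSubdivision K₀ S K p) : Triangulation Y :=
  triangulationOfBijective h.finite (fun x => e ⟨combo p x.1, h.bijOn.mapsTo x.2⟩)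
    (e.continuous.comp ((continuousOn_iff_continuous_domRestrict.1
      (continuousOn_combo h.finite p)).subtype_mk fun x => h.bijOn.mapsTo x.2))
    (e.bijective.comp (by
      have := h.bijOn.bijective
      exact this))

theorem subdivide_homeo [T2Space Y] {K₀ S K : NatComplex} {p : ℕ → ℕ → ℝ}
    (e : realization K₀ ≃ₜ Y) (h : IsSubdivision K₀ S K p)
    (x : realization (subdivide e h).complex) :
    (subdivide e h).homeo x = e ⟨combo p x.1, h.bijOn.mapsTo x.2⟩ := rfl

theorem combo_pi_single (p : ℕ → ℕ → ℝ) (v : ℕ) : combo p (Pi.single v 1) = p v := by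
  ext w
  rw [combo_eq_sum (s := {v}) fun u hu => Pi.single_eq_of_ne (by simpa using hu) _]
  simp

/-- A triangulated compact space has triangulations on whose simplices a given continuous map
varies little. -/
theorem exists_fine [T2Space Y] (T : Triangulation Y) {X : Type*} [PseudoMetricSpace X] (f : C(Y, X))
    {δ : ℝ} (hδ : 0 < δ) :
    ∃ S : Triangulation Y, ∀ s ∈ S.complex.faces, ∀ x : realization S.complex, InSimplex s x.1 →
      ∀ v ∈ s, ∀ hv : {v} ∈ S.complex.faces, dist (f (S.homeo x)) (f (S.vertex hv)) < δ := by
  obtain ⟨ε, hε, hH⟩ := exists_coord_modulus (isCompact_realization T.finite_faces)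
    (H := fun x => f (T.homeo x)) (f.continuous.comp T.homeo.continuous) hδ
  have hbot : (⊥ : NatComplex) ≤ T.complex := bot_le
  -- With nothing kept fixed, `β = -1` is allowed; as coordinates are nonnegative it rules out the
  -- first alternative of `IsFine`, and the choice of `a` is immaterial.
  obtain ⟨K, p, h, hfine⟩ := exists_fine_subdivision (a := 0) (β := -1) T.finite_faces hbot
    (fun h => h) (Or.inr fun s h => h) hε
  refine ⟨subdivide T.homeo h, fun s hs x hx v hv hvK => ?_⟩
  rw [vertex, subdivide_homeo, subdivide_homeo]
  refine hH _ _ fun w => ?_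
  simp only [combo_pi_single]
  rcases hfine s hs with h' | h'
  · obtain ⟨τ, -, hτ⟩ := h.carrier s hs
    have h1 := h' v hv
    have h2 := (hτ v hv).nonneg 0
    linarith
  · have h1 : combo p x.1 w - p v w = ∑ u ∈ s, x.1 u * (p u w - p v w) := by
      simp only [mul_sub, Finset.sum_sub_distrib]
      rw [combo_eq_sum hx.zero, ← Finset.sum_mul, hx.sum, one_mul]
    rw [h1]
    refine (Finset.abs_sum_le_sum_abs _ _).trans ?_
    calc ∑ u ∈ s, |x.1 u * (p u w - p v w)| ≤ ∑ u ∈ s, x.1 u * ε := by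
          refine Finset.sum_le_sum fun u hu => ?_
          rw [abs_mul, abs_of_nonneg (hx.nonneg u)]
          exact mul_le_mul_of_nonneg_left (h' u hu v hv w) (hx.nonneg u)
      _ = ε := by rw [← Finset.sum_mul, hx.sum, one_mul]

end Triangulation

/-! ### The boundary of the cross-polytope -/

section CrossPolytope

/-- The boundary of the cross-polytope in `ℝⁿ`: the vertices `2 j` and `2 j + 1` are opposite. -/
def crossPolytope (n : ℕ) : NatComplex where
  faces := {s | s.Nonempty ∧ (∀ v ∈ s, v < 2 * n) ∧ ∀ j, ¬ (2 * j ∈ s ∧ 2 * j + 1 ∈ s)}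
  isRelLowerSet_faces := fun _ hs =>
    ⟨hs.1, fun _ hts ht => ⟨ht, fun v hv => hs.2.1 v (hts hv),
      fun j hj => hs.2.2 j ⟨hts hj.1, hts hj.2⟩⟩⟩

theorem crossPolytope_finite (n : ℕ) : (crossPolytope n).faces.Finite := by
  refine (Finset.finite_toSet (Finset.range (2 * n)).powerset).subset fun s hs => ?_
  simp only [Finset.coe_powerset, Set.mem_preimage, Set.mem_powerset_iff]
  intro v hv
  simpa using hs.2.1 v hv

theorem sum_range_two_mul (F : ℕ → ℝ) (n : ℕ) :
    ∑ v ∈ Finset.range (2 * n), F v = ∑ j ∈ Finset.range n, (F (2 * j) + F (2 * j + 1)) := by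
  induction n with
  | zero => simp
  | succ n ih =>
    rw [show 2 * (n + 1) = 2 * n + 1 + 1 by ring, Finset.sum_range_succ, Finset.sum_range_succ, ih,
      Finset.sum_range_succ]
    ring

variable {n : ℕ}

/-- The coordinates of a vector, extended by zero. -/
noncomputable def coordOrZero (w : EuclideanSpace ℝ (Fin n)) (j : ℕ) : ℝ :=
  if h : j < n then w ⟨j, h⟩ else 0

theorem continuous_coordOrZero (j : ℕ) :
    Continuous fun w : EuclideanSpace ℝ (Fin n) => coordOrZero w j := by
  unfold coordOrZero
  split_ifs with h
  · fun_prop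
  · exact continuous_const

/-- The `ℓ¹` norm. -/
noncomputable def l1norm (w : EuclideanSpace ℝ (Fin n)) : ℝ :=
  ∑ j ∈ Finset.range n, |coordOrZero w j|

theorem continuous_l1norm : Continuous (l1norm (n := n)) :=
  continuous_finsetSum _ fun j _ => (continuous_coordOrZero j).abs

theorem coordOrZero_smul (c : ℝ) (w : EuclideanSpace ℝ (Fin n)) (j : ℕ) :
    coordOrZero (c • w) j = c * coordOrZero w j := by
  unfold coordOrZero
  split_ifs <;> simp

theorem l1norm_smul (c : ℝ) (w : EuclideanSpace ℝ (Fin n)) : l1norm (c • w) = |c| * l1norm w := by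
  simp only [l1norm, coordOrZero_smul, abs_mul, Finset.mul_sum]

theorem ext_coordOrZero {w w' : EuclideanSpace ℝ (Fin n)}
    (h : ∀ j, coordOrZero w j = coordOrZero w' j) : w = w' := by
  ext j
  simpa [coordOrZero] using h j

theorem l1norm_pos {w : EuclideanSpace ℝ (Fin n)} (hw : w ≠ 0) : 0 < l1norm w := by
  refine lt_of_le_of_ne (Finset.sum_nonneg fun j _ => abs_nonneg _) fun h => hw ?_
  refine ext_coordOrZero fun j => ?_
  by_cases hj : j < n
  · have := (Finset.sum_eq_zero_iff_of_nonneg fun j _ => abs_nonneg (coordOrZero w j)).1 h.symm j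
      (Finset.mem_range.2 hj)
    rw [abs_eq_zero.1 this]
    simp [coordOrZero]
  · simp [coordOrZero, hj]

/-- The barycentric coordinates, in the boundary of the cross-polytope, of the radial projection
of `w`. -/
noncomputable def crossCoord (w : EuclideanSpace ℝ (Fin n)) (v : ℕ) : ℝ :=
  max ((-1) ^ v * coordOrZero w (v / 2)) 0 / l1norm w

theorem crossCoord_even (w : EuclideanSpace ℝ (Fin n)) (j : ℕ) :
    crossCoord w (2 * j) = max (coordOrZero w j) 0 / l1norm w := by
  simp [crossCoord]

theorem crossCoord_odd (w : EuclideanSpace ℝ (Fin n)) (j : ℕ) :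
    crossCoord w (2 * j + 1) = max (-coordOrZero w j) 0 / l1norm w := by
  have : (2 * j + 1) / 2 = j := by omega
  simp [crossCoord, this, pow_succ]

/-- Positive part minus negative part: the coordinates determine `w` up to a positive factor. -/
theorem crossCoord_sub (w : EuclideanSpace ℝ (Fin n)) (j : ℕ) :
    crossCoord w (2 * j) - crossCoord w (2 * j + 1) = coordOrZero w j / l1norm w := by
  rw [crossCoord_even, crossCoord_odd, ← sub_div]
  congr 1
  rcases le_total (coordOrZero w j) 0 with h | h
  · rw [max_eq_right h, max_eq_left (by linarith)]; ring
  · rw [max_eq_left h, max_eq_right (by linarith)]; ring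

theorem crossCoord_mem {w : EuclideanSpace ℝ (Fin n)} (hw : w ≠ 0) :
    crossCoord w ∈ realization (crossPolytope n) := by
  have hl := l1norm_pos hw
  have h0 : ∀ v, 0 ≤ crossCoord w v := fun v => div_nonneg (le_max_right _ _) hl.le
  have hsum : ∑ v ∈ Finset.range (2 * n), crossCoord w v = 1 := by
    rw [sum_range_two_mul, ← div_self hl.ne', l1norm, Finset.sum_div]
    refine Finset.sum_congr rfl fun j _ => ?_
    rw [crossCoord_even, crossCoord_odd, ← add_div, l1norm]
    congr 1
    rcases le_total (coordOrZero w j) 0 with h | h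
    · rw [max_eq_right h, max_eq_left (by linarith), abs_of_nonpos h, zero_add]
    · rw [max_eq_left h, max_eq_right (by linarith), abs_of_nonneg h, add_zero]
  have hout : ∀ v, v ∉ Finset.range (2 * n) → crossCoord w v = 0 := fun v hv => by
    have : ¬ v / 2 < n := by
      rw [Finset.mem_range] at hv
      omega
    simp [crossCoord, coordOrZero, this]
  have hsum' : ∑ v ∈ (Finset.range (2 * n)).filter fun v => 0 < crossCoord w v, crossCoord w v = 1 := by
    rw [← hsum, Finset.sum_filter]
    refine Finset.sum_congr rfl fun v _ => ?_
    split_ifs with h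
    · rfl
    · exact le_antisymm (h0 v) (not_lt.1 h)
  refine ⟨(Finset.range (2 * n)).filter fun v => 0 < crossCoord w v, ⟨?_, ?_, ?_⟩, h0, ?_, hsum'⟩
  · rw [Finset.nonempty_iff_ne_empty]
    intro he
    rw [he] at hsum'
    simp at hsum'
  · intro v hv
    exact Finset.mem_range.1 (Finset.mem_filter.1 hv).1
  · rintro j ⟨h1, h2⟩
    have h1 := (Finset.mem_filter.1 h1).2
    have h2 := (Finset.mem_filter.1 h2).2
    rw [crossCoord_even] at h1
    rw [crossCoord_odd] at h2
    rcases le_total (coordOrZero w j) 0 with h | h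
    · rw [max_eq_right h, zero_div] at h1
      exact lt_irrefl _ h1
    · rw [max_eq_right (by linarith), zero_div] at h2
      exact lt_irrefl _ h2
  · intro v hv
    by_cases hv' : v ∈ Finset.range (2 * n)
    · exact le_antisymm (not_lt.1 fun h => hv (Finset.mem_filter.2 ⟨hv', h⟩)) (h0 v)
    · exact hout v hv'

theorem crossCoord_smul {c : ℝ} (hc : 0 < c) (w : EuclideanSpace ℝ (Fin n)) :
    crossCoord (c • w) = crossCoord w := by
  ext v
  simp only [crossCoord, coordOrZero_smul, l1norm_smul, abs_of_pos hc]
  rw [show (-1 : ℝ) ^ v * (c * coordOrZero w (v / 2)) = c * ((-1) ^ v * coordOrZero w (v / 2)) by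
    ring, show (0 : ℝ) = c * 0 by ring, ← mul_max_of_nonneg _ _ hc.le, mul_zero,
    mul_div_mul_left _ _ hc.ne']

/-- Opposite vertices never share a face, so one coordinate of each pair vanishes and the
differences recover both. -/
theorem exists_crossCoord_eq {x : ℕ → ℝ} (hx : x ∈ realization (crossPolytope n)) :
    ∃ d : EuclideanSpace ℝ (Fin n), d ≠ 0 ∧ crossCoord d = x := by
  obtain ⟨s, ⟨-, hs, hopp⟩, h0, hout, hsum⟩ := hx
  let d : EuclideanSpace ℝ (Fin n) := WithLp.toLp 2 fun j => x (2 * j) - x (2 * j + 1)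
  have hd : ∀ j, coordOrZero d j = x (2 * j) - x (2 * j + 1) := by
    intro j
    by_cases hj : j < n
    · simp [coordOrZero, hj, d]
    · rw [coordOrZero, dif_neg hj, hout (2 * j) fun h => by have := hs _ h; omega,
        hout (2 * j + 1) fun h => by have := hs _ h; omega, sub_zero]
  have hz : ∀ j, x (2 * j) = 0 ∨ x (2 * j + 1) = 0 := by
    intro j
    by_contra! h
    exact hopp j ⟨by_contra fun h' => h.1 (hout _ h'), by_contra fun h' => h.2 (hout _ h')⟩
  have hl : l1norm d = 1 := by
    have hsub : s ⊆ Finset.range (2 * n) := fun v hv => Finset.mem_range.2 (hs v hv)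
    rw [← hsum, Finset.sum_subset hsub fun v _ hv => hout v hv, sum_range_two_mul, l1norm]
    refine Finset.sum_congr rfl fun j _ => ?_
    rw [hd]
    rcases hz j with h | h
    · rw [h, zero_sub, abs_neg, abs_of_nonneg (h0 _), zero_add]
    · rw [h, sub_zero, abs_of_nonneg (h0 _), add_zero]
  refine ⟨d, ?_, ?_⟩
  · intro h
    rw [h] at hl
    simp [l1norm, coordOrZero] at hl
  · ext v
    rcases Nat.even_or_odd' v with ⟨j, rfl | rfl⟩
    · rw [crossCoord_even, hl, div_one, hd]
      rcases hz j with h | h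
      · rw [h, zero_sub, max_eq_right (neg_nonpos.2 (h0 _))]
      · rw [h, sub_zero, max_eq_left (h0 _)]
    · rw [crossCoord_odd, hl, div_one, hd]
      rcases hz j with h | h
      · rw [h, zero_sub, neg_neg, max_eq_left (h0 _)]
      · rw [h, sub_zero, max_eq_right (neg_nonpos.2 (h0 _))]

theorem coe_sphere_ne_zero {i : ℕ} (w : USphere i) : (w : EuclideanSpace ℝ (Fin (i + 1))) ≠ 0 :=
  fun h => by
    have := mem_sphere_zero_iff_norm.1 w.2
    rw [h, norm_zero] at this
    exact zero_ne_one this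

/-- The triangulation of the sphere as the boundary of the cross-polytope. -/
theorem exists_sphere_triangulation (i : ℕ) : Nonempty (Triangulation (USphere i)) := by
  let g : USphere i → realization (crossPolytope (i + 1)) := fun w =>
    ⟨crossCoord w.1, crossCoord_mem (coe_sphere_ne_zero w)⟩
  have hg : Continuous g := by
    refine Continuous.subtype_mk (continuous_pi fun v => ?_) _
    refine Continuous.div ?_ (continuous_l1norm.comp continuous_subtype_val) fun w =>
      (l1norm_pos (coe_sphere_ne_zero w)).ne'
    exact ((continuous_const.mul ((continuous_coordOrZero _).comp continuous_subtype_val)).max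
      continuous_const)
  have hinj : Function.Injective g := by
    intro w w' h
    have hl := l1norm_pos (coe_sphere_ne_zero w)
    have hl' := l1norm_pos (coe_sphere_ne_zero w')
    have h1 : crossCoord w.1 = crossCoord w'.1 := congrArg Subtype.val h
    -- Equal coordinates give positive proportionality; equal Euclidean norms then make the ratio 1.
    have h2 : w.1 = (l1norm w.1 / l1norm w'.1) • w'.1 := by
      refine ext_coordOrZero fun j => ?_
      have := crossCoord_sub w.1 j
      rw [h1, crossCoord_sub, div_eq_div_iff hl'.ne' hl.ne'] at this
      rw [coordOrZero_smul]
      field_simp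
      linarith
    have h3 : l1norm w.1 / l1norm w'.1 = 1 := by
      have := congrArg norm h2
      rw [norm_smul, mem_sphere_zero_iff_norm.1 w.2, mem_sphere_zero_iff_norm.1 w'.2, mul_one,
        Real.norm_of_nonneg (div_pos hl hl').le] at this
      exact this.symm
    rw [h3, one_smul] at h2
    exact Subtype.ext h2
  have hsurj : Function.Surjective g := by
    rintro ⟨x, hx⟩
    obtain ⟨d, hd, rfl⟩ := exists_crossCoord_eq hx
    have hd' : 0 < ‖d‖⁻¹ := inv_pos.2 (norm_pos_iff.2 hd)
    refine ⟨⟨‖d‖⁻¹ • d, ?_⟩, Subtype.ext (crossCoord_smul hd' d)⟩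
    rw [mem_sphere_zero_iff_norm, norm_smul, norm_inv, norm_norm,
      inv_mul_cancel₀ (norm_ne_zero_iff.2 hd)]
  exact ⟨⟨crossPolytope (i + 1), crossPolytope_finite _, (Continuous.homeoOfEquivCompactToT2
    (f := Equiv.ofBijective g ⟨hinj, hsurj⟩) hg).symm⟩⟩

end CrossPolytope

/-! ### The cone on a triangulated sphere -/

section Cone

/-- The cone with apex `a`. -/
def coneComplex (S : NatComplex) (a : ℕ) : NatComplex where
  faces := {s | s.Nonempty ∧ (s.erase a = ∅ ∨ s.erase a ∈ S.faces)}
  isRelLowerSet_faces := by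
    rintro s ⟨hs, h⟩
    refine ⟨hs, fun t hts ht => ⟨ht, ?_⟩⟩
    have hsub := Finset.erase_subset_erase a hts
    rcases (t.erase a).eq_empty_or_nonempty with h' | h'
    · exact Or.inl h'
    · right
      rcases h with h | h
      · rw [h] at hsub
        exact absurd (Finset.subset_empty.1 hsub) h'.ne_empty
      · exact face_subset h hsub h'

theorem coneComplex_finite {S : NatComplex} (hS : S.faces.Finite) (a : ℕ) :
    (coneComplex S a).faces.Finite := by
  refine (((hS.insert ∅).image fun s => s) |>.union ((hS.insert ∅).image fun s => insert a s)).subset ?_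
  rintro s ⟨-, h⟩
  have h' : s.erase a ∈ insert ∅ S.faces := h
  by_cases ha : a ∈ s
  · exact Or.inr ⟨s.erase a, h', Finset.insert_erase ha⟩
  · exact Or.inl ⟨s.erase a, h', Finset.erase_eq_of_notMem ha⟩

theorem le_coneComplex {S : NatComplex} {a : ℕ} (ha : {a} ∉ S.faces) : S ≤ coneComplex S a := by
  intro s hs
  refine ⟨face_nonempty hs, Or.inr ?_⟩
  rw [Finset.erase_eq_of_notMem fun h => ha (singleton_face hs h)]
  exact hs

variable {i : ℕ} (S : Triangulation (USphere i))

open Classical in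
/-- The barycentric coordinates of a unit vector. -/
noncomputable def sphereCoord (w : EuclideanSpace ℝ (Fin (i + 1))) : ℕ → ℝ :=
  if hw : w ∈ USphere i then (S.homeo.symm ⟨w, hw⟩).1 else 0

/-- The barycentric coordinates of a point of the ball in the cone with apex `a`. -/
noncomputable def coneCoord (a : ℕ) (w : EuclideanSpace ℝ (Fin (i + 1))) (v : ℕ) : ℝ :=
  if v = a then 1 - ‖w‖ else ‖w‖ * sphereCoord S (‖w‖⁻¹ • w) v

theorem sphereCoord_coe (w : USphere i) : sphereCoord S w = (S.homeo.symm w).1 :=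
  dif_pos w.2

theorem inv_norm_smul_mem_sphere {w : EuclideanSpace ℝ (Fin (i + 1))} (hw : w ≠ 0) :
    ‖w‖⁻¹ • w ∈ USphere i := by
  rw [mem_sphere_zero_iff_norm, norm_smul, norm_inv, norm_norm,
    inv_mul_cancel₀ (norm_ne_zero_iff.2 hw)]

variable {S} {a : ℕ}

theorem coneCoord_apex (w : EuclideanSpace ℝ (Fin (i + 1))) : coneCoord S a w a = 1 - ‖w‖ :=
  if_pos rfl

theorem coneCoord_smul {t : ℝ} (ht : 0 < t) (z : USphere i) {v : ℕ} (hv : v ≠ a) :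
    coneCoord S a (t • z.1) v = t * (S.homeo.symm z).1 v := by
  have hz := mem_sphere_zero_iff_norm.1 z.2
  rw [coneCoord, if_neg hv, norm_smul, hz, mul_one, Real.norm_of_nonneg ht.le,
    inv_smul_smul₀ ht.ne', sphereCoord_coe]

theorem eq_smul_sphere {w : EuclideanSpace ℝ (Fin (i + 1))} (hw : w ≠ 0) :
    ∃ z : USphere i, w = ‖w‖ • z.1 :=
  ⟨⟨_, inv_norm_smul_mem_sphere hw⟩, (smul_inv_smul₀ (norm_ne_zero_iff.2 hw) w).symm⟩

theorem coneCoord_zero : coneCoord S a 0 = Pi.single a 1 := by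
  ext v
  by_cases hv : v = a
  · subst hv; simp [coneCoord]
  · simp [coneCoord, hv]

theorem coneCoord_mem (ha : {a} ∉ S.complex.faces) {w : EuclideanSpace ℝ (Fin (i + 1))}
    (hw : ‖w‖ ≤ 1) : coneCoord S a w ∈ realization (coneComplex S.complex a) := by
  rcases eq_or_ne w 0 with rfl | hw0
  · rw [coneCoord_zero]
    exact vertex_mem_realization ⟨by simp, Or.inl (by simp)⟩
  · obtain ⟨z, hz⟩ := eq_smul_sphere hw0
    have ht : 0 < ‖w‖ := norm_pos_iff.2 hw0
    obtain ⟨s, hs, h0, hout, hsum⟩ := (S.homeo.symm z).2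
    have has : a ∉ s := fun h => ha (singleton_face hs h)
    have hcoord : ∀ v, v ≠ a → coneCoord S a w v = ‖w‖ * (S.homeo.symm z).1 v := by
      intro v hv
      have := coneCoord_smul (S := S) ht z hv
      rwa [← hz] at this
    refine ⟨insert a s, ⟨by simp, Or.inr (by simpa [has] using hs)⟩, fun v => ?_, fun v hv => ?_, ?_⟩
    · by_cases hv : v = a
      · subst hv
        rw [coneCoord_apex]
        linarith
      · rw [hcoord v hv]
        exact mul_nonneg ht.le (h0 v)
    · simp only [Finset.mem_insert, not_or] at hv
      rw [hcoord v hv.1, hout v hv.2, mul_zero]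
    · rw [Finset.sum_insert has, coneCoord_apex,
        Finset.sum_congr rfl fun v hv => hcoord v fun h => has (h ▸ hv), ← Finset.mul_sum, hsum]
      ring

/-- Only the origin is in doubt. There the spherical coordinates have no limit in general, but they
are bounded by 1 and are multiplied by `‖w‖`. -/
theorem continuous_coneCoord : Continuous fun w : UBall i => coneCoord S a w.1 := by
  refine continuous_pi fun v => ?_
  by_cases hv : v = a
  · subst hv
    simp only [coneCoord_apex]
    fun_prop
  have hbound : ∀ w : EuclideanSpace ℝ (Fin (i + 1)), |coneCoord S a w v| ≤ ‖w‖ := by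
    intro w
    rcases eq_or_ne w 0 with rfl | hw0
    · simp [coneCoord, hv]
    · rw [coneCoord, if_neg hv, abs_mul, abs_norm,
        sphereCoord_coe S ⟨_, inv_norm_smul_mem_sphere hw0⟩]
      refine mul_le_of_le_one_right (norm_nonneg _) ?_
      rw [abs_of_nonneg (realization_nonneg (S.homeo.symm _).2 v)]
      exact realization_le_one (S.homeo.symm _).2 v
  have hcs : ContinuousOn (fun w => sphereCoord S w v) (USphere i) := by
    rw [continuousOn_iff_continuous_domRestrict]
    have : (USphere i).domRestrict (fun w => sphereCoord S w v) = fun w => (S.homeo.symm w).1 v := by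
      ext w
      simp only [domRestrict_apply, sphereCoord_coe]
    rw [this]
    exact (continuous_apply v).comp (continuous_subtype_val.comp S.homeo.symm.continuous)
  have hE : Continuous fun w : EuclideanSpace ℝ (Fin (i + 1)) => coneCoord S a w v := by
    rw [continuous_iff_continuousAt]
    intro w
    rcases eq_or_ne w 0 with rfl | hw0
    · rw [ContinuousAt, coneCoord_zero, Pi.single_eq_of_ne hv]
      refine squeeze_zero_norm hbound ?_
      simpa using (continuous_norm (E := EuclideanSpace ℝ (Fin (i + 1)))).tendsto 0
    · have h1 : ContinuousOn (fun w : EuclideanSpace ℝ (Fin (i + 1)) =>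
          ‖w‖ * sphereCoord S (‖w‖⁻¹ • w) v) {0}ᶜ := by
        refine continuous_norm.continuousOn.mul (hcs.comp ?_ fun w hw => inv_norm_smul_mem_sphere hw)
        exact (continuous_norm.continuousOn.inv₀ fun w hw => norm_ne_zero_iff.2 hw).smul
          continuousOn_id
      have h2 := h1.continuousAt (isOpen_compl_singleton.mem_nhds hw0)
      simpa only [coneCoord, if_neg hv] using h2
  exact hE.comp continuous_subtype_val

theorem coneCoord_injective (ha : {a} ∉ S.complex.faces) {w w' : EuclideanSpace ℝ (Fin (i + 1))}
    (h : coneCoord S a w = coneCoord S a w') : w = w' := by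
  have hnorm : ‖w‖ = ‖w'‖ := by
    have := congrFun h a
    rw [coneCoord_apex, coneCoord_apex] at this
    linarith
  rcases eq_or_ne w 0 with rfl | hw0
  · rw [norm_zero] at hnorm
    exact (norm_eq_zero.1 hnorm.symm).symm
  · have ht : 0 < ‖w‖ := norm_pos_iff.2 hw0
    have hw0' : w' ≠ 0 := norm_pos_iff.1 (hnorm ▸ ht)
    obtain ⟨z, hz⟩ := eq_smul_sphere hw0
    obtain ⟨z', hz'⟩ := eq_smul_sphere hw0'
    rw [← hnorm] at hz'
    suffices z = z' by rw [hz, hz', this]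
    refine S.homeo.symm.injective (Subtype.ext (funext fun v => ?_))
    by_cases hv : v = a
    · subst hv
      have haux : ∀ z : USphere i, (S.homeo.symm z).1 v = 0 := fun z =>
        le_antisymm (not_lt.1 fun h => ha (singleton_face_of_pos (S.homeo.symm z).2 h))
          (realization_nonneg (S.homeo.symm z).2 v)
      rw [haux, haux]
    · have h1 := congrFun h v
      rw [hz, hz', coneCoord_smul ht z hv, coneCoord_smul ht z' hv] at h1
      exact mul_left_cancel₀ ht.ne' h1

/-- Unless `x` is the apex, dropping the apex coordinate and rescaling gives a point of the
realization of `S`; `1 - x a` is the radius. -/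
theorem exists_coneCoord_eq {x : ℕ → ℝ}
    (hx : x ∈ realization (coneComplex S.complex a)) :
    ∃ w : EuclideanSpace ℝ (Fin (i + 1)), ‖w‖ ≤ 1 ∧ coneCoord S a w = x := by
  have hxa := realization_le_one hx a
  obtain ⟨s, hs, hpos, h0, hsum⟩ := exists_support hx
  have hout : ∀ v, v ∉ s → x v = 0 := fun v hv =>
    le_antisymm (not_lt.1 fun h => hv ((hpos v).2 h)) (h0 v)
  have hsum' : ∑ v ∈ s.erase a, x v = 1 - x a := by
    by_cases has : a ∈ s
    · rw [← hsum, ← Finset.add_sum_erase _ _ has]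
      ring
    · rw [Finset.erase_eq_of_notMem has, hsum, hout a has, sub_zero]
  rcases hs.2 with he | he
  · rw [he, Finset.sum_empty] at hsum'
    refine ⟨0, by simp, ?_⟩
    rw [coneCoord_zero]
    ext v
    by_cases hv : v = a
    · subst hv
      rw [Pi.single_eq_same]
      linarith
    · rw [Pi.single_eq_of_ne hv]
      refine (hout v fun hvs => ?_).symm
      have : v ∈ s.erase a := Finset.mem_erase.2 ⟨hv, hvs⟩
      rw [he] at this
      simp at this
  · have ht : 0 < 1 - x a := by
      rw [← hsum']
      exact Finset.sum_pos (fun v hv => (hpos v).1 (Finset.mem_of_mem_erase hv)) (face_nonempty he)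
    let y : ℕ → ℝ := fun v => if v = a then 0 else (1 - x a)⁻¹ * x v
    have hy : y ∈ realization S.complex := by
      refine ⟨s.erase a, he, fun v => ?_, fun v hv => ?_, ?_⟩
      · simp only [y]
        split_ifs
        exacts [le_rfl, mul_nonneg (inv_nonneg.2 ht.le) (h0 v)]
      · simp only [y]
        split_ifs with hva
        · rfl
        · rw [hout v fun h => hv (Finset.mem_erase.2 ⟨hva, h⟩), mul_zero]
      · rw [Finset.sum_congr rfl fun v hv => if_neg (Finset.ne_of_mem_erase hv), ← Finset.mul_sum,
          hsum', inv_mul_cancel₀ ht.ne']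
    have hz := mem_sphere_zero_iff_norm.1 (S.homeo ⟨y, hy⟩).2
    have hnorm : ‖(1 - x a) • (S.homeo ⟨y, hy⟩).1‖ = 1 - x a := by
      rw [norm_smul, hz, mul_one, Real.norm_of_nonneg ht.le]
    refine ⟨(1 - x a) • (S.homeo ⟨y, hy⟩).1, ?_, ?_⟩
    · rw [hnorm]
      linarith [h0 a]
    · ext v
      by_cases hv : v = a
      · subst hv
        rw [coneCoord_apex, hnorm]
        ring
      · rw [coneCoord_smul ht _ hv, Homeomorph.symm_apply_apply]
        simp only [y, if_neg hv]
        rw [mul_inv_cancel_left₀ ht.ne']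

variable (S) in
/-- The ball is the cone on a triangulated sphere. -/
theorem exists_coneHomeo (ha : {a} ∉ S.complex.faces) :
    ∃ e : realization (coneComplex S.complex a) ≃ₜ UBall i,
      ∀ w, (e.symm w).1 = coneCoord S a w.1 := by
  let g : UBall i → realization (coneComplex S.complex a) := fun w =>
    ⟨coneCoord S a w.1, coneCoord_mem ha (mem_closedBall_zero_iff.1 w.2)⟩
  have hbij : Function.Bijective g := by
    refine ⟨fun w w' h => Subtype.ext (coneCoord_injective ha (congrArg Subtype.val h)), ?_⟩
    rintro ⟨x, hx⟩
    obtain ⟨w, hw, rfl⟩ := exists_coneCoord_eq hx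
    exact ⟨⟨w, mem_closedBall_zero_iff.2 hw⟩, rfl⟩
  exact ⟨(Continuous.homeoOfEquivCompactToT2 (f := Equiv.ofBijective g hbij)
    (continuous_coneCoord.subtype_mk _)).symm, fun w => rfl⟩

/-- A triangulation `S` of the sphere bounds triangulations of the ball each of whose simplices
either lies in the outer half of the cone over a simplex of `S`, or is so small that a given
continuous map varies little on its vertices. -/
theorem exists_ball_triangulation (S : Triangulation (USphere i)) {X : Type*} [PseudoMetricSpace X]
    (H : C(UBall i, X)) {δ : ℝ} (hδ : 0 < δ) :
    ∃ B : Triangulation (UBall i), IsBoundaryTriangulation S B ∧ ∀ s ∈ B.complex.faces,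
      (∃ τ ∈ S.complex.faces, ∀ v ∈ s, ∀ hv : {v} ∈ B.complex.faces, ∃ (z : USphere i) (t : ℝ),
        1 / 2 ≤ t ∧ (B.vertex hv).1 = t • z.1 ∧ ∀ u, 0 < (S.homeo.symm z).1 u → u ∈ τ) ∨
      ∀ u ∈ s, ∀ hu : {u} ∈ B.complex.faces, ∀ v ∈ s, ∀ hv : {v} ∈ B.complex.faces,
        dist (H (B.vertex hu)) (H (B.vertex hv)) < δ := by
  obtain ⟨a, haM⟩ := exists_vertex_bound S.finite_faces
  have ha : {a} ∉ S.complex.faces := fun h => lt_irrefl a (haM _ h a (Finset.mem_singleton_self a))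
  obtain ⟨e, he⟩ := exists_coneHomeo S ha
  obtain ⟨ε, hε, hH⟩ := exists_coord_modulus
    (isCompact_realization (coneComplex_finite S.finite_faces a)) (H := fun x => H (e x))
    (H.continuous.comp e.continuous) hδ
  -- The coordinate at the apex is `1 - ‖w‖`, so the bound `β = 1 / 2` on it describes the outer
  -- half of the ball.
  obtain ⟨K, p, h, hfine⟩ := exists_fine_subdivision (coneComplex_finite S.finite_faces a)
    (le_coneComplex ha) ha (Or.inl (one_half_pos (α := ℝ))) hε
  have hvert : ∀ v, ∀ hv : {v} ∈ (Triangulation.subdivide e h).complex.faces,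
      coneCoord S a ((Triangulation.subdivide e h).vertex hv).1 = p v := by
    intro v hv
    rw [Triangulation.vertex, Triangulation.subdivide_homeo, ← he, Homeomorph.symm_apply_apply]
    exact Triangulation.combo_pi_single p v
  refine ⟨Triangulation.subdivide e h, ⟨h.le, fun x hxS hxB => ?_⟩, fun s hs => ?_⟩
  · rw [Triangulation.subdivide_homeo]
    refine e.symm.injective (Subtype.ext ?_)
    rw [Homeomorph.symm_apply_apply, he]
    -- The subdivision leaves the vertices of `S` in place, so it restricts to the given
    -- triangulation on the boundary.
    have hcombo : combo p x = x := by
      obtain ⟨s, hs, hxs⟩ := mem_realization_iff.1 hxS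
      rw [← combo_single hxs.zero]
      ext w
      rw [combo_single hxs.zero, combo_eq_sum hxs.zero]
      conv_rhs => rw [← combo_single hxs.zero, combo_eq_sum hxs.zero]
      exact Finset.sum_congr rfl fun v hv => by rw [h.point_eq v (singleton_face hs hv)]
    change combo p x = coneCoord S a (S.homeo ⟨x, hxS⟩).1
    rw [hcombo]
    ext v
    by_cases hv : v = a
    · subst hv
      rw [coneCoord_apex, mem_sphere_zero_iff_norm.1 (S.homeo ⟨x, hxS⟩).2, sub_self]
      exact le_antisymm (not_lt.1 fun h' => ha (singleton_face_of_pos hxS h'))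
        (realization_nonneg hxS v)
    · have := coneCoord_smul (S := S) one_pos (S.homeo ⟨x, hxS⟩) hv
      rw [one_smul, Homeomorph.symm_apply_apply, one_mul] at this
      exact this.symm
  · rcases hfine s hs with h' | h'
    · left
      obtain ⟨τ, hτ, hcar⟩ := h.carrier s hs
      -- If the carrier were the apex alone, the apex coordinate would be 1, above the bound `1 /
      -- 2`.
      have hτa : τ.erase a ∈ S.complex.faces := by
        refine hτ.2.resolve_left fun hemp => ?_
        obtain ⟨v, hv⟩ := face_nonempty hs
        have h1 := (hcar v hv).sum
        have h2 : ∑ u ∈ τ, p v u ≤ p v a := by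
          have hsub : τ ⊆ {a} := by
            intro u hu
            rw [Finset.mem_singleton]
            by_contra hua
            have : u ∈ τ.erase a := Finset.mem_erase.2 ⟨hua, hu⟩
            rw [hemp] at this
            simp at this
          calc ∑ u ∈ τ, p v u ≤ ∑ u ∈ {a}, p v u :=
                Finset.sum_le_sum_of_subset_of_nonneg hsub fun u _ _ => (hcar v hv).nonneg u
            _ = p v a := Finset.sum_singleton _ _
        have h3 := h' v hv
        linarith
      refine ⟨τ.erase a, hτa, fun v hv hvK => ?_⟩
      have hpv := hvert v hvK
      set w := ((Triangulation.subdivide e h).vertex hvK).1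
      have hw : 1 / 2 ≤ ‖w‖ := by
        have h3 := h' v hv
        rw [← hpv, coneCoord_apex] at h3
        linarith
      have hw0 : w ≠ 0 := norm_pos_iff.1 (by linarith)
      obtain ⟨z, hz⟩ := eq_smul_sphere hw0
      refine ⟨z, ‖w‖, hw, hz, fun u hu => ?_⟩
      have hua : u ≠ a := by
        rintro rfl
        exact ha (singleton_face_of_pos (S.homeo.symm z).2 hu)
      refine Finset.mem_erase.2 ⟨hua, ?_⟩
      by_contra huτ
      have h4 := (hcar v hv).zero u huτ
      rw [← hpv, hz, coneCoord_smul (by linarith) z hua] at h4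
      have : 0 < ‖w‖ * (S.homeo.symm z).1 u := mul_pos (by linarith) hu
      linarith
    · right
      intro u hu huK v hv hvK
      have h1 := hH (e.symm ((Triangulation.subdivide e h).vertex huK))
        (e.symm ((Triangulation.subdivide e h).vertex hvK)) fun w => by
          rw [he, he, hvert, hvert]
          exact h' u hu v hv w
      simpa using h1

end Cone

/-! ### The cubical grid -/

namespace Grid

variable {m : ℕ}

/-- The smallest closed cell of the integral cubical grid that contains `x`. -/
def cell (x : Fin m → ℝ) : Set (Fin m → ℝ) := {y | ∀ k, (⌊x k⌋ : ℝ) ≤ y k ∧ y k ≤ ⌈x k⌉}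

open Classical in
/-- The non-integral coordinates of `x`. -/
noncomputable def free (x : Fin m → ℝ) : Finset (Fin m) :=
  {k | x k ∉ range ((↑) : ℤ → ℝ)}

/-- The `j`-skeleton of the integral cubical grid. -/
def skel (m j : ℕ) : Set (Fin m → ℝ) := {x | (free x).card ≤ j}

theorem mem_free {x : Fin m → ℝ} {k : Fin m} : k ∈ free x ↔ x k ∉ range ((↑) : ℤ → ℝ) := by
  simp [free]

theorem mem_cell_self (x : Fin m → ℝ) : x ∈ cell x := fun _ => ⟨Int.floor_le _, Int.le_ceil _⟩

theorem eq_of_mem_cell {x y : Fin m → ℝ} (hy : y ∈ cell x) {k : Fin m} (hk : k ∉ free x) :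
    y k = x k := by
  rw [mem_free, not_not] at hk
  obtain ⟨z, hz⟩ := hk
  have h := hy k
  rw [← hz, Int.floor_intCast, Int.ceil_intCast] at h
  rw [← hz]
  exact le_antisymm h.2 h.1

theorem ceil_eq_floor_add_one {x : Fin m → ℝ} {k : Fin m} (hk : k ∈ free x) :
    (⌈x k⌉ : ℝ) = ⌊x k⌋ + 1 := by
  rw [mem_free] at hk
  have h1 : ⌈x k⌉ = ⌊x k⌋ + 1 := by
    refine le_antisymm (Int.ceil_le_floor_add_one _) ?_
    rw [Int.add_one_le_iff, Int.lt_ceil]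
    exact lt_of_le_of_ne (Int.floor_le _) fun h => hk ⟨_, h⟩
  rw [h1]
  push_cast
  ring

theorem free_subset {x y : Fin m → ℝ} (hy : y ∈ cell x) : free y ⊆ free x := by
  intro k hk
  by_contra hkx
  rw [mem_free, eq_of_mem_cell hy hkx] at hk
  exact hkx (mem_free.2 hk)

theorem floor_eq {x y : Fin m → ℝ} (hy : y ∈ cell x) (h : free x ⊆ free y) (k : Fin m) :
    ⌊y k⌋ = ⌊x k⌋ ∧ ⌈y k⌉ = ⌈x k⌉ := by
  by_cases hk : k ∈ free x
  · have hky := mem_free.1 (h hk)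
    have hyk := hy k
    have hc := ceil_eq_floor_add_one hk
    have h1 : (⌊x k⌋ : ℝ) ≠ y k := fun h' => hky ⟨_, h'⟩
    have h2 : (⌈x k⌉ : ℝ) ≠ y k := fun h' => hky ⟨_, h'⟩
    have h3 := lt_of_le_of_ne hyk.1 h1
    have h4 := lt_of_le_of_ne hyk.2 h2.symm
    refine ⟨Int.floor_eq_iff.2 ⟨h3.le, by linarith⟩, Int.ceil_eq_iff.2 ⟨by linarith, h4.le⟩⟩
  · rw [eq_of_mem_cell hy hk]
    exact ⟨rfl, rfl⟩

theorem mem_cell_symm {x y : Fin m → ℝ} (hy : y ∈ cell x) (h : free x ⊆ free y) : x ∈ cell y := by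
  intro k
  rw [(floor_eq hy h k).1, (floor_eq hy h k).2]
  exact mem_cell_self x k

theorem isClosed_cell (x : Fin m → ℝ) : IsClosed (cell x) := by
  simp only [cell, ofPred_forall]
  exact isClosed_iInter fun k => (isClosed_le continuous_const (continuous_apply k)).inter
    (isClosed_le (continuous_apply k) continuous_const)

theorem isClosed_skel (m j : ℕ) : IsClosed (skel m j) := by
  have : skel m j = ⋃ J ∈ {J : Finset (Fin m) | J.card ≤ j},
      {x : Fin m → ℝ | ∀ k, k ∉ J → x k ∈ range ((↑) : ℤ → ℝ)} := by
    ext x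
    simp only [mem_iUnion, exists_prop]
    constructor
    · intro hx
      exact ⟨free x, hx, fun k hk => by rwa [mem_free, not_not] at hk⟩
    · rintro ⟨J, hJ, hx⟩
      refine (Finset.card_le_card fun k hk => ?_).trans hJ
      by_contra hkJ
      exact mem_free.1 hk (hx k hkJ)
  rw [this]
  refine Set.Finite.isClosed_biUnion (Set.toFinite _) fun J _ => ?_
  simp only [ofPred_forall]
  exact isClosed_iInter fun k => isClosed_iInter fun _ =>
    Int.isClosedEmbedding_coe_real.isClosed_range.preimage (continuous_apply k)

/-- A canonical point in the interior of the smallest cell that contains `x`. -/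
noncomputable def center (x : Fin m → ℝ) : Fin m → ℝ := fun k => (⌊x k⌋ + ⌈x k⌉) / 2

theorem center_mem_cell (x : Fin m → ℝ) : center x ∈ cell x := fun k => by
  have h : (⌊x k⌋ : ℝ) ≤ ⌈x k⌉ := (Int.floor_le _).trans (Int.le_ceil _)
  constructor <;> simp only [center] <;> linarith

theorem free_subset_free_center (x : Fin m → ℝ) : free x ⊆ free (center x) := by
  intro k hk
  rw [mem_free]
  rintro ⟨z, hz⟩
  simp only [center, ceil_eq_floor_add_one hk] at hz
  have h1 : (2 * z : ℝ) = 2 * ⌊x k⌋ + 1 := by linarith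
  have h2 : 2 * z = 2 * ⌊x k⌋ + 1 := by exact_mod_cast h1
  omega

theorem free_center (x : Fin m → ℝ) : free (center x) = free x :=
  Finset.Subset.antisymm (free_subset (center_mem_cell x)) (free_subset_free_center x)

theorem center_eq {x y : Fin m → ℝ} (hy : y ∈ cell x) (h : free x ⊆ free y) :
    center y = center x := by
  ext k
  simp only [center, (floor_eq hy h k).1, (floor_eq hy h k).2]

theorem center_center (x : Fin m → ℝ) : center (center x) = center x :=
  center_eq (center_mem_cell x) (free_subset_free_center x)

theorem finite_image_center {Z : Set (Fin m → ℝ)} (hZ : Bornology.IsBounded Z) :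
    (center '' Z).Finite := by
  obtain ⟨N, hN⟩ := hZ.exists_norm_le
  have h1 : (Set.pi univ fun _ : Fin m => Icc (-(⌈N⌉ + 1)) (⌈N⌉ + 1) ×ˢ
      Icc (-(⌈N⌉ + 1)) (⌈N⌉ + 1) : Set (Fin m → ℤ × ℤ)).Finite :=
    Set.Finite.pi fun _ => (Set.finite_Icc _ _).prod (Set.finite_Icc _ _)
  refine (h1.image fun q k => (((q k).1 : ℝ) + (q k).2) / 2).subset ?_
  rintro _ ⟨x, hx, rfl⟩
  refine ⟨fun k => (⌊x k⌋, ⌈x k⌉), fun k _ => ?_, rfl⟩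
  have hk : |x k| ≤ N := (norm_le_pi_norm x k).trans (hN x hx)
  have hN' := Int.le_ceil N
  rw [abs_le] at hk
  refine ⟨⟨Int.le_floor.2 ?_, ?_⟩, ⟨?_, Int.ceil_le.2 ?_⟩⟩
  · push_cast; linarith
  · exact (Int.floor_le_iff.2 (by push_cast; linarith))
  · have := Int.le_ceil (x k)
    have h2 : (-(⌈N⌉ + 1 : ℝ)) ≤ ⌈x k⌉ := by linarith
    exact_mod_cast h2
  · push_cast; linarith

/-- The sup-norm ball is homeomorphic to the Euclidean ball. -/
theorem exists_cubeHomeo (d : ℕ) : ∃ Ψ : (Fin d → ℝ) ≃ₜ EuclideanSpace ℝ (Fin d),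
    (∀ u, Ψ u ∈ Metric.closedBall 0 1 ↔ ‖u‖ ≤ 1) ∧ ∀ u, Ψ u ∈ Metric.sphere 0 1 ↔ ‖u‖ = 1 := by
  let L := EuclideanSpace.equiv (Fin d) ℝ
  let Lh := L.toHomeomorph
  set s : Set (EuclideanSpace ℝ (Fin d)) := Lh ⁻¹' Metric.closedBall 0 1 with hs
  have hconv : Convex ℝ s := (convex_closedBall (0 : Fin d → ℝ) 1).linear_preimage
    (L.toLinearEquiv : EuclideanSpace ℝ (Fin d) →ₗ[ℝ] Fin d → ℝ)
  have hbdd : Bornology.IsBounded s := by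
    have h1 : s = L.symm '' Metric.closedBall 0 1 := by
      rw [L.symm.image_eq_preimage_symm]
      rfl
    rw [h1]
    exact ((isCompact_closedBall (0 : Fin d → ℝ) 1).image L.symm.continuous).isBounded
  have hint : (interior s).Nonempty := by
    rw [hs, ← Lh.preimage_interior, interior_closedBall _ one_ne_zero]
    exact ⟨0, by simp [Lh]⟩
  obtain ⟨h, -, hcl, hfr⟩ :=
    exists_homeomorph_image_interior_closure_frontier_eq_unitBall hconv hint hbdd
  have hclosed : IsClosed s := Metric.isClosed_closedBall.preimage Lh.continuous
  rw [hclosed.closure_eq] at hcl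
  rw [hs, ← Lh.preimage_frontier, frontier_closedBall _ one_ne_zero] at hfr
  refine ⟨Lh.symm.trans h, fun u => ?_, fun u => ?_⟩
  · rw [← hcl, Homeomorph.trans_apply, h.injective.mem_set_image, hs, mem_preimage,
      Homeomorph.apply_symm_apply, mem_closedBall_zero_iff]
  · rw [← hfr, Homeomorph.trans_apply, h.injective.mem_set_image, mem_preimage,
      Homeomorph.apply_symm_apply, mem_sphere_zero_iff_norm]

/-- Extending a map from the boundary of a cell to the cell. -/
theorem exists_extend_cell {X : Type*} [TopologicalSpace X] {j : ℕ} {C D : Set X}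
    (hext : SphereMapsExtend j C D) {x : Fin m → ℝ} (hx : (free x).card = j + 1)
    {g : (Fin m → ℝ) → X} (hg : ContinuousOn g (cell x ∩ skel m j))
    (hgC : ∀ y ∈ cell x ∩ skel m j, g y ∈ C) :
    ∃ H : (Fin m → ℝ) → X, ContinuousOn H (cell x) ∧ EqOn H g (cell x ∩ skel m j) ∧
      ∀ y ∈ cell x, H y ∈ D := by
  classical
  obtain ⟨Ψ, hball, hsphere⟩ := exists_cubeHomeo (j + 1)
  let e : Fin (j + 1) ≃ free x := (Finset.equivFinOfCardEq hx).symm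
  -- `P` maps the cube `[-1, 1]^(j+1)` affinely onto the cell, with inverse `Q`; the boundary of the
  -- cube corresponds to the points of the cell in the `j`-skeleton.
  let P : (Fin (j + 1) → ℝ) → Fin m → ℝ := fun u k =>
    if hk : k ∈ free x then ⌊x k⌋ + (u (e.symm ⟨k, hk⟩) + 1) / 2 else x k
  let Q : (Fin m → ℝ) → Fin (j + 1) → ℝ := fun y l => 2 * (y (e l) - ⌊x (e l)⌋) - 1
  have hPcont : Continuous P := by
    refine continuous_pi fun k => ?_
    by_cases hk : k ∈ free x
    · simp only [P, hk, dif_pos]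
      fun_prop
    · simp only [P, hk]
      exact continuous_const
  have hQcont : Continuous Q := by fun_prop
  have hPQ : ∀ y ∈ cell x, P (Q y) = y := by
    intro y hy
    ext k
    by_cases hk : k ∈ free x
    · simp only [P, Q, hk, dif_pos, Equiv.apply_symm_apply]
      ring
    · simp only [P, hk, dif_neg, not_false_eq_true]
      exact (eq_of_mem_cell hy hk).symm
  have hQnorm : ∀ y ∈ cell x, ‖Q y‖ ≤ 1 := by
    intro y hy
    rw [pi_norm_le_iff_of_nonneg zero_le_one]
    intro l
    have h1 := hy (e l)
    rw [ceil_eq_floor_add_one (e l).2] at h1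
    rw [Real.norm_eq_abs, abs_le]
    simp only [Q]
    constructor <;> linarith
  have hQbd : ∀ y ∈ cell x, y ∈ skel m j → ‖Q y‖ = 1 := by
    intro y hy hys
    -- A point of the `j`-skeleton has fewer free coordinates than the cell, so one of them sits at
    -- an end of its unit interval.
    obtain ⟨k, hk, hky⟩ : ∃ k ∈ free x, k ∉ free y := by
      by_contra! hcon
      have h1 := Finset.card_le_card hcon
      rw [hx] at h1
      have h2 : (free y).card ≤ j := hys
      omega
    rw [mem_free, not_not] at hky
    obtain ⟨z, hz⟩ := hky
    have h1 := hy k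
    rw [ceil_eq_floor_add_one hk, ← hz] at h1
    have h2 : ⌊x k⌋ ≤ z := by exact_mod_cast h1.1
    have h3 : z ≤ ⌊x k⌋ + 1 := by exact_mod_cast h1.2
    have h4 : |Q y (e.symm ⟨k, hk⟩)| = 1 := by
      simp only [Q, Equiv.apply_symm_apply, ← hz]
      rcases h2.eq_or_lt with h | h
      · rw [h, sub_self]
        norm_num
      · have : z = ⌊x k⌋ + 1 := by omega
        rw [this]
        push_cast
        rw [add_sub_cancel_left]
        norm_num
    refine le_antisymm (hQnorm y hy) ?_
    rw [← h4, ← Real.norm_eq_abs]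
    exact norm_le_pi_norm (Q y) _
  have hPcell : ∀ u, ‖u‖ = 1 → P u ∈ cell x ∩ skel m j := by
    intro u hu
    have hul : ∀ l, |u l| ≤ 1 := fun l => (norm_le_pi_norm u l).trans hu.le
    have hcell : P u ∈ cell x := by
      intro k
      by_cases hk : k ∈ free x
      · have := abs_le.1 (hul (e.symm ⟨k, hk⟩))
        simp only [P, hk, dif_pos, ceil_eq_floor_add_one hk]
        constructor <;> linarith
      · simp only [P, hk, dif_neg, not_false_eq_true]
        exact mem_cell_self x k
    refine ⟨hcell, ?_⟩
    obtain ⟨l, hl⟩ : ∃ l, |u l| = 1 := by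
      by_contra! hcon
      have : ‖u‖ < 1 := (pi_norm_lt_iff one_pos).2 fun l => lt_of_le_of_ne (hul l) (hcon l)
      exact this.ne hu
    have hlt : free (P u) ⊂ free x := by
      refine Finset.ssubset_iff_subset_ne.2 ⟨free_subset hcell, fun heq => ?_⟩
      have hmem : (e l : Fin m) ∈ free (P u) := by
        rw [heq]
        exact (e l).2
      refine mem_free.1 hmem ?_
      simp only [P, (e l).2, dif_pos, Subtype.coe_eta, Equiv.symm_apply_apply]
      rcases eq_or_eq_neg_of_abs_eq hl with h | h
      · exact ⟨⌊x (e l)⌋ + 1, by rw [h]; push_cast; ring⟩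
      · exact ⟨⌊x (e l)⌋, by rw [h]; ring⟩
    have := Finset.card_lt_card hlt
    rw [hx] at this
    exact Nat.lt_succ_iff.1 this
  have hnorm : ∀ s : USphere j, ‖Ψ.symm s.1‖ = 1 := fun s => by
    rw [← hsphere, Homeomorph.apply_symm_apply]
    exact s.2
  let f : C(USphere j, X) := ⟨fun s => g (P (Ψ.symm s.1)), hg.comp_continuous
    (hPcont.comp (Ψ.symm.continuous.comp continuous_subtype_val)) fun s => hPcell _ (hnorm s)⟩
  obtain ⟨F, hFD, hFf⟩ := hext f fun s => hgC _ (hPcell _ (hnorm s))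
  have hmem : ∀ y : cell x, Ψ (Q y) ∈ UBall j := fun y => (hball _).2 (hQnorm y y.2)
  refine ⟨fun y => if hy : Ψ (Q y) ∈ UBall j then F ⟨_, hy⟩ else g y, ?_, ?_, ?_⟩
  · rw [continuousOn_iff_continuous_domRestrict]
    have : (cell x).domRestrict (fun y => if hy : Ψ (Q y) ∈ UBall j then F ⟨_, hy⟩ else g y) =
        fun y : cell x => F ⟨Ψ (Q y), hmem y⟩ := by
      ext y
      exact dif_pos (hmem y)
    rw [this]
    exact F.continuous.comp
      ((Ψ.continuous.comp (hQcont.comp continuous_subtype_val)).subtype_mk _)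
  · intro y hy
    have hs : Ψ (Q y) ∈ USphere j := (hsphere _).2 (hQbd y hy.1 hy.2)
    have h1 := hFf ⟨_, hs⟩
    simp only [hmem ⟨y, hy.1⟩, dif_pos]
    refine h1.trans ?_
    simp only [f, ContinuousMap.coe_mk, Homeomorph.symm_apply_apply, hPQ y hy.1]
  · intro y hy
    simp only [hmem ⟨y, hy⟩, dif_pos]
    exact hFD _

/-- A set that contains, with a point, the smallest cell around it. -/
def CellClosed (Z : Set (Fin m → ℝ)) : Prop := ∀ x ∈ Z, cell x ⊆ Z

/-- Extension over the cells of dimension `j + 1`. -/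
theorem exists_extend_skel {X : Type*} [PseudoMetricSpace X] {j : ℕ} {r R : ℝ} (hR : 0 < R)
    (hr : 0 < r)
    (hext : ∀ c : X, SphereMapsExtend j (Metric.ball c r) (Metric.ball c R))
    {Z A : Set (Fin m → ℝ)} (hZc : IsClosed Z) (hZb : Bornology.IsBounded Z) (hZ : CellClosed Z)
    (hAc : IsClosed A) (hA : CellClosed A) {g : (Fin m → ℝ) → X}
    (hg : ContinuousOn g (A ∪ Z ∩ skel m j))
    (hdist : ∀ x ∈ Z, ∀ y ∈ cell x, dist (g y) (g x) < r) :
    ∃ G : (Fin m → ℝ) → X, ContinuousOn G (A ∪ Z ∩ skel m (j + 1)) ∧ EqOn G g A ∧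
      ∀ x, dist (G x) (g x) < R + r := by
  classical
  set D := A ∪ Z ∩ skel m j with hD
  set W := (Z ∩ skel m (j + 1)) \ D with hW
  have hDc : IsClosed D := hAc.union (hZc.inter (isClosed_skel m j))
  have hcard : ∀ x ∈ W, (free x).card = j + 1 := fun x hx => by
    have h1 : (free x).card ≤ j + 1 := hx.1.2
    have h2 : ¬ (free x).card ≤ j := fun h => hx.2 (Or.inr ⟨hx.1.1, h⟩)
    omega
  -- An interior point of the cell in `A` would put the whole cell in `A`, including `x`, which is
  -- not in `D`. Thus `g` is prescribed at most on the boundary of the cell.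
  have hcellD : ∀ x ∈ W, ∀ y ∈ cell x, y ∈ D → y ∈ skel m j := by
    intro x hx y hy hyD
    rcases hyD with hyA | hyZ
    · by_contra hys
      have h1 : ¬ (free y).card ≤ j := hys
      have h2 : free y = free x := Finset.eq_of_subset_of_card_le (free_subset hy) (by
        rw [hcard x hx]; omega)
      exact hx.2 (Or.inl (hA y hyA (mem_cell_symm hy h2.symm.subset)))
    · exact hyZ.2
  have hcellnD : ∀ x ∈ W, ∀ y ∈ cell x, y ∉ D → center y = center x := by
    intro x hx y hy hyD
    have hyZ := hZ x hx.1.1 hy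
    have h1 : ¬ (free y).card ≤ j := fun h => hyD (Or.inr ⟨hyZ, h⟩)
    have h2 : free y = free x := Finset.eq_of_subset_of_card_le (free_subset hy) (by
      rw [hcard x hx]; omega)
    exact center_eq hy h2.symm.subset
  have hcenterW : ∀ x ∈ W, center x ∈ W := by
    intro x hx
    refine ⟨⟨hZ x hx.1.1 (center_mem_cell x), ?_⟩, fun h => ?_⟩
    · change (free (center x)).card ≤ j + 1
      rw [free_center, hcard x hx]
    · have h1 : (free (center x)).card ≤ j := hcellD x hx _ (center_mem_cell x) h
      rw [free_center, hcard x hx] at h1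
      omega
  have hH : ∀ c ∈ W, ∃ H : (Fin m → ℝ) → X, ContinuousOn H (cell c) ∧
      EqOn H g (cell c ∩ skel m j) ∧ ∀ y ∈ cell c, H y ∈ Metric.ball (g c) R := fun c hc =>
    exists_extend_cell (hext (g c)) (hcard c hc)
      (hg.mono fun y hy => Or.inr ⟨hZ c hc.1.1 hy.1, hy.2⟩) fun y hy => hdist c hc.1.1 y hy.1
  have : Nonempty X := ⟨g 0⟩
  choose! H hHc hHg hHR using hH
  -- Indexing the extensions by `center y` makes all interior points of a cell use the same one.
  let G : (Fin m → ℝ) → X := fun y =>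
    if y ∈ D then g y else if y ∈ Z ∩ skel m (j + 1) then H (center y) y else g y
  have hGD : EqOn G g D := fun y hy => if_pos hy
  have hGcell : ∀ c ∈ W, EqOn G (H (center c)) (cell (center c)) := by
    intro c hc y hy
    have hc' := hcenterW c hc
    by_cases hyD : y ∈ D
    · rw [hGD hyD]
      exact (hHg _ hc' ⟨hy, hcellD _ hc' y hy hyD⟩).symm
    · have hyS : y ∈ Z ∩ skel m (j + 1) := by
        refine ⟨hZ _ hc'.1.1 hy, ?_⟩
        exact (Finset.card_le_card (free_subset hy)).trans (hcard _ hc').le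
      simp only [G, if_neg hyD, if_pos hyS]
      rw [hcellnD _ hc' y hy hyD, center_center]
  refine ⟨G, ?_, hGD.mono subset_union_left, fun x => ?_⟩
  · have hfin : (center '' W).Finite :=
      finite_image_center (hZb.subset fun x hx => hx.1.1)
    have hunion : ContinuousOn G (⋃ c : center '' W, cell c.1) := by
      have : Finite (center '' W) := hfin
      refine (locallyFinite_of_finite _).continuousOn_iUnion (fun c => isClosed_cell _) ?_
      rintro ⟨_, c, hc, rfl⟩
      exact (hHc _ (hcenterW c hc)).congr (hGcell c hc)
    have hclosed : IsClosed (⋃ c : center '' W, cell c.1) := by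
      have : Finite (center '' W) := hfin
      exact isClosed_iUnion_of_finite fun c => isClosed_cell _
    refine ((hg.congr hGD).union_of_isClosed hunion hDc hclosed).mono ?_
    intro x hx
    by_cases hxD : x ∈ D
    · exact Or.inl hxD
    · have hxW : x ∈ W := ⟨hx.resolve_left fun h => hxD (Or.inl h), hxD⟩
      exact Or.inr (mem_iUnion.2 ⟨⟨_, x, hxW, rfl⟩,
        mem_cell_symm (center_mem_cell x) (free_subset_free_center x)⟩)
  · by_cases hxD : x ∈ D
    · rw [hGD hxD, dist_self]
      positivity
    · by_cases hxS : x ∈ Z ∩ skel m (j + 1)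
      · have hxW : x ∈ W := ⟨hxS, hxD⟩
        have hxc := mem_cell_symm (center_mem_cell x) (free_subset_free_center x)
        rw [hGcell x hxW hxc]
        refine (dist_triangle _ (g (center x)) _).trans_lt (add_lt_add ?_ ?_)
        · exact hHR _ (hcenterW x hxW) x hxc
        · exact hdist x hxS.1 _ (center_mem_cell x)
      · simp only [G, if_neg hxD, if_neg hxS, dist_self]
        positivity

/-- A map that varies little on cells is close to a map that is continuous on a skeleton. -/
theorem exists_extend {X : Type*} [MetricSpace X] {n : ℕ} (hX : UniformlyConnected n X) :
    ∀ d ≤ n + 1, ∀ r > 0, ∃ R > 0, ∀ (m : ℕ) (Z A : Set (Fin m → ℝ)), IsClosed Z →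
      Bornology.IsBounded Z → CellClosed Z → IsClosed A → CellClosed A →
      ∀ g : (Fin m → ℝ) → X, ContinuousOn g A →
        (∀ x ∈ Z, ∀ y ∈ cell x, dist (g y) (g x) < r) →
        ∃ G : (Fin m → ℝ) → X, ContinuousOn G (A ∪ Z ∩ skel m d) ∧ EqOn G g A ∧
          ∀ x, dist (G x) (g x) < R := by
  intro d
  induction d with
  | zero =>
    intro _ r hr
    refine ⟨1, one_pos, fun m Z A hZc hZb hZ hAc hA g hg hdist => ⟨g, ?_, fun _ _ => rfl, by simp⟩⟩
    -- A bounded set has finitely many integral points, on which continuity is automatic.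
    have hfin : (Z ∩ skel m 0).Finite := by
      refine (finite_image_center hZb).subset fun x hx => ⟨x, hx.1, ?_⟩
      have hfree : free x = ∅ := Finset.card_eq_zero.1 (Nat.le_zero.1 hx.2)
      ext k
      exact eq_of_mem_cell (center_mem_cell x) (by simp [hfree])
    exact hg.union_of_isClosed (hfin.continuousOn g) hAc hfin.isClosed
  | succ d ih =>
    intro hd r hr
    obtain ⟨R, hR, h⟩ := ih (by omega) r hr
    -- `2 * R + r` bounds the variation on a cell of a map `R`-close to `g`.
    obtain ⟨R', hR', hext⟩ := hX d (by omega) (2 * R + r) (by positivity)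
    refine ⟨R' + (2 * R + r) + R, by positivity, fun m Z A hZc hZb hZ hAc hA g hg hdist => ?_⟩
    obtain ⟨G, hG, hGA, hGd⟩ := h m Z A hZc hZb hZ hAc hA g hg hdist
    obtain ⟨G', hG', hGA', hGd'⟩ := exists_extend_skel hR' (by positivity) hext hZc hZb hZ hAc hA hG
      fun x hx y hy => by
        have h1 := dist_triangle4 (G y) (g y) (g x) (G x)
        have h2 := hGd x
        rw [dist_comm] at h2
        linarith [hGd y, hdist x hx y hy]
    refine ⟨G', hG', hGA'.trans hGA, fun x => ?_⟩
    linarith [dist_triangle (G' x) (G x) (g x), hGd' x, hGd x]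

theorem cellClosed_closedBall (N : ℕ) : CellClosed (Metric.closedBall (0 : Fin m → ℝ) N) := by
  intro x hx y hy
  rw [mem_closedBall_zero_iff, pi_norm_le_iff_of_nonneg (by positivity)] at hx ⊢
  intro k
  have h1 := abs_le.1 (hx k)
  have h2 : (-N : ℤ) ≤ ⌊x k⌋ := Int.le_floor.2 (by push_cast; exact h1.1)
  have h3 : ⌈x k⌉ ≤ (N : ℤ) := Int.ceil_le.2 (by exact_mod_cast h1.2)
  have h2' : (-N : ℝ) ≤ ⌊x k⌋ := by exact_mod_cast h2
  have h3' : (⌈x k⌉ : ℝ) ≤ N := by exact_mod_cast h3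
  rw [Real.norm_eq_abs, abs_le]
  exact ⟨h2'.trans (hy k).1, (hy k).2.trans h3'⟩

theorem exists_notMem_free {N : ℕ} (hN : 0 < N) {x : Fin m → ℝ} (hx : ‖x‖ = N) :
    ∃ k, k ∉ free x ∧ ‖x k‖ = N := by
  obtain ⟨k, hk⟩ : ∃ k, ‖x k‖ = N := by
    by_contra! hcon
    have : ‖x‖ < N := (pi_norm_lt_iff (by exact_mod_cast hN)).2 fun k =>
      lt_of_le_of_ne ((norm_le_pi_norm x k).trans hx.le) (hcon k)
    exact this.ne hx
  refine ⟨k, ?_, hk⟩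
  rw [mem_free, not_not]
  rcases eq_or_eq_neg_of_abs_eq hk with h | h
  · exact ⟨N, by rw [h]; simp⟩
  · exact ⟨-N, by rw [h]; simp⟩

theorem cellClosed_sphere {N : ℕ} (hN : 0 < N) :
    CellClosed (Metric.sphere (0 : Fin m → ℝ) N) := by
  intro x hx y hy
  rw [mem_sphere_zero_iff_norm] at hx ⊢
  refine le_antisymm ?_ ?_
  · exact mem_closedBall_zero_iff.1
      (cellClosed_closedBall N x (mem_closedBall_zero_iff.2 hx.le) hy)
  · obtain ⟨k, hk, hxk⟩ := exists_notMem_free hN hx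
    rw [← hxk, ← eq_of_mem_cell hy hk]
    exact norm_le_pi_norm y k

/-- On a sup-norm sphere of integral radius some coordinate is `N` or `-N`, so it is not free. -/
theorem sphere_subset_skel {N i : ℕ} (hN : 0 < N) :
    Metric.sphere (0 : Fin (i + 1) → ℝ) N ⊆ skel (i + 1) i := by
  intro x hx
  obtain ⟨k, hk, -⟩ := exists_notMem_free hN (mem_sphere_zero_iff_norm.1 hx)
  have h1 : (free x).card < (Finset.univ : Finset (Fin (i + 1))).card :=
    Finset.card_lt_card (Finset.ssubset_univ_iff.2 fun h => hk (h ▸ Finset.mem_univ k))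
  rw [Finset.card_univ, Fintype.card_fin] at h1
  exact Nat.lt_succ_iff.1 h1

theorem dist_cell_le {x y : Fin m → ℝ} (hy : y ∈ cell x) : dist y x ≤ 1 := by
  rw [dist_pi_le_iff zero_le_one]
  intro k
  have h1 := hy k
  have h2 := Int.floor_le (x k)
  have h3 := Int.le_ceil (x k)
  have h4 := Int.lt_floor_add_one (x k)
  have h5 := Int.ceil_lt_add_one (x k)
  rw [Real.dist_eq, abs_le]
  constructor <;> linarith

end Grid

/-! ### Continuous approximation of coarsely continuous maps -/

/-- A map on a ball (or a sphere) that is coarsely continuous is close to a continuous map; on a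
part of the boundary where the map is continuous it need not be changed. -/
theorem exists_continuous_near {X : Type*} [MetricSpace X] {n : ℕ} (hX : UniformlyConnected n X)
    {i : ℕ} (hi : i ≤ n) {r : ℝ} (hr : 0 < r) :
    ∃ R > 0, ∀ (g : EuclideanSpace ℝ (Fin (i + 1)) → X) (δ : ℝ), 0 < δ →
      ((∀ x ∈ UBall i, ∀ y ∈ UBall i, dist x y < δ → dist (g x) (g y) < r) →
        ContinuousOn g (USphere i) →
          ∃ G : C(UBall i, X), (∀ s : USphere i, G (sphereInclusion i s) = g s) ∧
            ∀ y, dist (G y) (g y) < R) ∧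
      ((∀ x ∈ USphere i, ∀ y ∈ USphere i, dist x y < δ → dist (g x) (g y) < r) →
        ∃ G : C(USphere i, X), ∀ y, dist (G y) (g y) < R) := by
  obtain ⟨R₁, hR₁, h₁⟩ := Grid.exists_extend hX (i + 1) (by omega) r hr
  obtain ⟨R₂, hR₂, h₂⟩ := Grid.exists_extend hX i (by omega) r hr
  refine ⟨max R₁ R₂, lt_max_of_lt_left hR₁, fun g δ hδ => ?_⟩
  obtain ⟨Ψ, hball, hsphere⟩ := Grid.exists_cubeHomeo (i + 1)
  have hunif : UniformContinuousOn Ψ (Metric.closedBall 0 1) :=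
    (isCompact_closedBall _ _).uniformContinuousOn_of_continuous Ψ.continuous.continuousOn
  obtain ⟨η, hη, hΨ⟩ := Metric.uniformContinuousOn_iff.1 hunif δ hδ
  -- The mesh `1 / N` adapts to `δ`; `R₁` and `R₂` were fixed beforehand and hold for grids of every
  -- size.
  obtain ⟨N, hN⟩ := exists_nat_gt (1 / η)
  have hNpos : (0 : ℝ) < N := (by positivity : (0 : ℝ) < 1 / η).trans hN
  have hNpos' : 0 < N := by exact_mod_cast hNpos
  have hsmall : ∀ x y : Fin (i + 1) → ℝ, y ∈ Grid.cell x →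
      dist ((N : ℝ)⁻¹ • y) ((N : ℝ)⁻¹ • x) < η := by
    intro x y hy
    rw [dist_smul₀, norm_inv, Real.norm_natCast]
    have h1 := mul_le_mul_of_nonneg_left (Grid.dist_cell_le hy) (inv_nonneg.2 hNpos.le)
    rw [mul_one] at h1
    refine h1.trans_lt ?_
    rw [one_div] at hN
    exact inv_lt_of_inv_lt₀ hη hN
  have hnorm : ∀ x : Fin (i + 1) → ℝ, ‖(N : ℝ)⁻¹ • x‖ = (N : ℝ)⁻¹ * ‖x‖ := fun x => by
    rw [norm_smul, norm_inv, Real.norm_natCast]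
  have hb : ∀ x : Fin (i + 1) → ℝ, x ∈ Metric.closedBall 0 (N : ℝ) → ‖(N : ℝ)⁻¹ • x‖ ≤ 1 :=
    fun x hx => by
      rw [hnorm, inv_mul_le_iff₀ hNpos, mul_one]
      exact mem_closedBall_zero_iff.1 hx
  have hs : ∀ x : Fin (i + 1) → ℝ, x ∈ Metric.sphere 0 (N : ℝ) → ‖(N : ℝ)⁻¹ • x‖ = 1 :=
    fun x hx => by
      rw [hnorm, mem_sphere_zero_iff_norm.1 hx, inv_mul_cancel₀ hNpos.ne']
  let σ : (Fin (i + 1) → ℝ) → EuclideanSpace ℝ (Fin (i + 1)) := fun x => Ψ ((N : ℝ)⁻¹ • x)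
  have hσ : Continuous σ := Ψ.continuous.comp (continuous_const_smul _)
  let τ : EuclideanSpace ℝ (Fin (i + 1)) → Fin (i + 1) → ℝ := fun w => (N : ℝ) • Ψ.symm w
  have hτ : Continuous τ := (continuous_const_smul (N : ℝ)).comp Ψ.symm.continuous
  have hστ : ∀ w, σ (τ w) = w := fun w => by
    simp only [σ, τ, inv_smul_smul₀ hNpos.ne', Homeomorph.apply_symm_apply]
  have hτb : ∀ w ∈ UBall i, τ w ∈ Metric.closedBall 0 (N : ℝ) := fun w hw => by
    rw [mem_closedBall_zero_iff, norm_smul, Real.norm_natCast]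
    refine mul_le_of_le_one_right hNpos.le ((hball _).1 ?_)
    rwa [Homeomorph.apply_symm_apply]
  have hτs : ∀ w ∈ USphere i, τ w ∈ Metric.sphere 0 (N : ℝ) := fun w hw => by
    rw [mem_sphere_zero_iff_norm, norm_smul, Real.norm_natCast, (hsphere _).1, mul_one]
    rwa [Homeomorph.apply_symm_apply]
  constructor
  · intro hg hgs
    obtain ⟨G, hG, hGA, hGR⟩ := h₁ (i + 1) (Metric.closedBall 0 N) (Metric.sphere 0 N)
      Metric.isClosed_closedBall Metric.isBounded_closedBall (Grid.cellClosed_closedBall N)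
      Metric.isClosed_sphere (Grid.cellClosed_sphere hNpos') (fun x => g (σ x))
      (hgs.comp hσ.continuousOn fun x hx => (hsphere _).2 (hs x hx)) (fun x hx y hy => by
        have hy' := Grid.cellClosed_closedBall N x hx hy
        refine hg _ ((hball _).2 (hb y hy')) _ ((hball _).2 (hb x hx)) (hΨ _ ?_ _ ?_ (hsmall x y hy))
        · exact mem_closedBall_zero_iff.2 (hb y hy')
        · exact mem_closedBall_zero_iff.2 (hb x hx))
    have hskel : ∀ x, x ∈ Grid.skel (i + 1) (i + 1) := fun x =>
      (Finset.card_le_univ _).trans (Fintype.card_fin _).le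
    refine ⟨⟨fun w => G (τ w), hG.comp_continuous (hτ.comp continuous_subtype_val) fun w =>
      Or.inr ⟨hτb w w.2, hskel _⟩⟩, fun s => ?_, fun y => ?_⟩
    · refine (hGA (hτs s s.2)).trans ?_
      simp only [hστ]
    · have := hGR (τ y)
      simp only [hστ] at this
      exact this.trans_le (le_max_left _ _)
  · intro hg
    obtain ⟨G, hG, -, hGR⟩ := h₂ (i + 1) (Metric.sphere 0 N) ∅
      Metric.isClosed_sphere Metric.isBounded_sphere (Grid.cellClosed_sphere hNpos')
      isClosed_empty (fun x hx => absurd hx (notMem_empty x)) (fun x => g (σ x))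
      (continuousOn_empty _) (fun x hx y hy => by
        have hy' := Grid.cellClosed_sphere hNpos' x hx hy
        refine hg _ ((hsphere _).2 (hs y hy')) _ ((hsphere _).2 (hs x hx))
          (hΨ _ ?_ _ ?_ (hsmall x y hy))
        · exact mem_closedBall_zero_iff.2 (hs y hy').le
        · exact mem_closedBall_zero_iff.2 (hs x hx).le)
    refine ⟨⟨fun w => G (τ w), hG.comp_continuous (hτ.comp continuous_subtype_val) fun w =>
      Or.inr ⟨hτs w w.2, Grid.sphere_subset_skel hNpos' (hτs w w.2)⟩⟩, fun y => ?_⟩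
    have := hGR (τ y)
    simp only [hστ] at this
    exact this.trans_le (le_max_right _ _)

/-! ### Asymptotic and topological connectedness at infinity -/

theorem isSimplicialMap_ripsComplex_iff {V X : Type*} [MetricSpace X]
    {K : PreAbstractSimplicialComplex V} {R : ℝ} {D : Set X} {F : V → X} :
    IsSimplicialMap K (ripsComplex R D) F ↔ ∀ s ∈ K.faces,
      (∀ v ∈ s, F v ∈ D) ∧ ∀ u ∈ s, ∀ v ∈ s, dist (F u) (F v) ≤ R := by
  classical
  constructor
  · intro h s hs
    obtain ⟨-, h1, h2⟩ := h s hs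
    exact ⟨fun v hv => h1 (by simpa using ⟨v, hv, rfl⟩), fun u hu v hv =>
      h2 _ (by simpa using ⟨u, hu, rfl⟩) _ (by simpa using ⟨v, hv, rfl⟩)⟩
  · intro h s hs
    obtain ⟨h1, h2⟩ := h s hs
    refine ⟨(K.isRelLowerSet_faces.prop_of_mem hs).image _, ?_, ?_⟩
    · intro x hx
      obtain ⟨v, hv, rfl⟩ : ∃ v ∈ s, F v = x := by simpa using hx
      exact h1 v hv
    · intro x hx y hy
      obtain ⟨u, hu, rfl⟩ := Finset.mem_image.1 hx
      obtain ⟨v, hv, rfl⟩ := Finset.mem_image.1 hy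
      exact h2 u hu v hv

theorem IsBoundaryTriangulation.symm_apply {i : ℕ} {S : Triangulation (USphere i)}
    {B : Triangulation (UBall i)} (h : IsBoundaryTriangulation S B) (s : USphere i) :
    (B.homeo.symm (sphereInclusion i s)).1 = (S.homeo.symm s).1 := by
  have h1 := h.2 (S.homeo.symm s).1 (S.homeo.symm s).2 (realization_mono h.1 (S.homeo.symm s).2)
  rw [Subtype.coe_eta, Homeomorph.apply_symm_apply] at h1
  rw [← h1, Homeomorph.symm_apply_apply]

/-- Points at distance at most `r` from a set. -/
theorem isBounded_setOf_dist_le {X : Type*} [PseudoMetricSpace X] {K : Set X}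
    (hK : Bornology.IsBounded K) (r : ℝ) : Bornology.IsBounded {x | ∃ k ∈ K, dist x k ≤ r} := by
  refine (hK.cthickening (δ := r)).subset ?_
  rintro x ⟨k, hk, hxk⟩
  exact Metric.mem_cthickening_of_dist_le x k r K hk hxk

/-- Discretize the sphere map, fill it simplicially, and smooth the filling to a continuous map.
Properness makes `closure L` compact. -/
theorem piInftyVanishes_of_asPiInftyVanishes {X : Type*} [MetricSpace X] [ProperSpace X] {n : ℕ}
    (hX : UniformlyConnected n X) {i : ℕ} (hi : i ≤ n) (h : AsPiInftyVanishes i X) :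
    PiInftyVanishes i X := by
  classical
  intro K hK
  obtain ⟨R₁, hR₁, h⟩ := h 1 one_pos
  -- Neighbouring values of `g` below differ by at most `R₁ + 2`: `R₁` from the Rips complex and 1
  -- at each end. The approximation lemma asks for a strict bound.
  obtain ⟨R₂, hR₂, hnear⟩ := exists_continuous_near hX hi (r := R₁ + 3) (by positivity)
  -- The margin is `R₂` from `G` to `g` plus 1 from `g` to the simplicial filling.
  obtain ⟨L, hLb, hKL, hasph⟩ := h _ (isBounded_setOf_dist_le hK.isBounded (R₂ + 1))
  refine ⟨closure L, hLb.isCompact_closure, fun x hx => subset_closure (hKL ⟨x, hx, ?_⟩),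
    fun f hf => ?_⟩
  · rw [dist_self]
    positivity
  have hfL : ∀ s, f s ∈ Lᶜ := fun s h' => hf s (subset_closure h')
  obtain ⟨T⟩ := exists_sphere_triangulation i
  obtain ⟨S, hS⟩ := T.exists_fine f (one_half_pos (α := ℝ))
  -- A filler value for indices that are not vertices and for points outside the ball.
  let x₀ : X := f ⟨EuclideanSpace.single 0 1, by simp⟩
  let fv : ℕ → X := fun v => if hv : {v} ∈ S.complex.faces then f (S.vertex hv) else x₀
  have hfv : ∀ {v} (hv : {v} ∈ S.complex.faces), fv v = f (S.vertex hv) := fun hv => dif_pos hv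
  have hnearS : ∀ s ∈ S.complex.faces, ∀ x : realization S.complex, InSimplex s x.1 → ∀ v ∈ s,
      dist (f (S.homeo x)) (fv v) < 1 / 2 := fun s hs x hx v hv => by
    rw [hfv (singleton_face hs hv)]
    exact hS s hs x hx v hv _
  obtain ⟨B, F, hSB, hF, hFf⟩ := hasph S fv (isSimplicialMap_ripsComplex_iff.2 fun s hs => by
    refine ⟨fun v hv => ?_, fun u hu v hv => ?_⟩
    · rw [hfv (singleton_face hs hv)]
      exact hfL _
    · have h1 := hnearS s hs ⟨_, vertex_mem_realization (singleton_face hs hu)⟩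
        (InSimplex.single hu) v hv
      rw [hfv (singleton_face hs hu)]
      exact h1.le.trans (by norm_num))
  rw [isSimplicialMap_ripsComplex_iff] at hF
  obtain ⟨φ, hφ, δ, hδ, hφδ⟩ := B.exists_vertex_choice
  let g : EuclideanSpace ℝ (Fin (i + 1)) → X := fun y =>
    if hs : y ∈ USphere i then f ⟨y, hs⟩ else if hb : y ∈ UBall i then F (φ ⟨y, hb⟩) else x₀
  have hgs : ∀ s : USphere i, g s = f s := fun s => dif_pos s.2
  -- On the sphere the carrier in `B` is the carrier in `S`, on which `f` varies by less than `1 /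
  -- 2`.
  have hgF : ∀ y : UBall i, dist (g y) (F (φ y)) ≤ 1 := by
    intro y
    by_cases hy : y.1 ∈ USphere i
    · have h1 := hSB.symm_apply ⟨y.1, hy⟩
      have h2 := hφ y
      have h3 : sphereInclusion i ⟨y.1, hy⟩ = y := rfl
      rw [← h3, h1] at h2
      obtain ⟨s, hs, hpos, h0, hsum⟩ := exists_support (S.homeo.symm ⟨y.1, hy⟩).2
      have hvs : φ y ∈ s := (hpos _).2 h2
      have h4 := hnearS s hs (S.homeo.symm ⟨y.1, hy⟩) ⟨h0, fun v hv =>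
        le_antisymm (not_lt.1 fun h' => hv ((hpos v).2 h')) (h0 v), hsum⟩ _ hvs
      rw [Homeomorph.apply_symm_apply] at h4
      rw [hFf _ (singleton_face hs hvs), hgs ⟨y.1, hy⟩]
      linarith
    · have : g y = F (φ y) := by
        simp only [g, dif_neg hy, dif_pos y.2]
      rw [this, dist_self]
      exact zero_le_one
  obtain ⟨G, hGs, hGg⟩ := (hnear g δ hδ).1 (fun x hx y hy hxy => by
      obtain ⟨s, hs, h1, h2⟩ := hφδ ⟨x, hx⟩ ⟨y, hy⟩ hxy
      have h3 := (hF s hs).2 _ h1 _ h2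
      have h4 := hgF ⟨x, hx⟩
      have h5 := hgF ⟨y, hy⟩
      rw [dist_comm] at h5
      have h6 := dist_triangle4 (g x) (F (φ ⟨x, hx⟩)) (F (φ ⟨y, hy⟩)) (g y)
      change dist (g x) _ ≤ 1 at h4
      change dist _ (g y) ≤ 1 at h5
      linarith) (by
      rw [continuousOn_iff_continuous_domRestrict]
      have : (USphere i).domRestrict g = f := funext hgs
      rw [this]
      exact f.continuous)
  refine ⟨G, fun y hy => ?_, fun s => (hGs s).trans (hgs s)⟩
  obtain ⟨s, hs, h1, -⟩ := hφδ y y (by rwa [dist_self])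
  refine (hF s hs).1 _ h1 ⟨G y, hy, ?_⟩
  have h2 := hgF y
  have h3 := hGg y
  have h4 := dist_triangle (F (φ y)) (g y) (G y)
  rw [dist_comm] at h2 h3
  linarith

/-- The radial map of the ball to itself that is the radial projection to the sphere on the outer
half. -/
noncomputable def radialPush (i : ℕ) : C(UBall i, UBall i) where
  toFun w := ⟨(max (1 / 2) ‖w.1‖)⁻¹ • w.1, by
    have h1 : 0 < max (1 / 2) ‖w.1‖ := lt_max_of_lt_left one_half_pos
    rw [mem_closedBall_zero_iff, norm_smul, norm_inv, Real.norm_of_nonneg h1.le,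
      inv_mul_le_iff₀ h1, mul_one]
    exact le_max_right _ _⟩
  continuous_toFun := by
    have h1 : Continuous fun w : UBall i => max (1 / 2) ‖w.1‖ := by fun_prop
    have h2 : ∀ w : UBall i, max (1 / 2) ‖w.1‖ ≠ 0 := fun w =>
      (lt_max_of_lt_left one_half_pos).ne'
    exact ((h1.inv₀ h2).smul continuous_subtype_val).subtype_mk _

theorem radialPush_apply {i : ℕ} {w : UBall i} {z : USphere i} {t : ℝ} (ht : 1 / 2 ≤ t)
    (hw : w.1 = t • z.1) : radialPush i w = sphereInclusion i z := by
  have ht0 : 0 < t := by linarith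
  have h1 : ‖w.1‖ = t := by
    rw [hw, norm_smul, mem_sphere_zero_iff_norm.1 z.2, mul_one, Real.norm_of_nonneg ht0.le]
  refine Subtype.ext ?_
  change (max (1 / 2) ‖w.1‖)⁻¹ • w.1 = z.1
  rw [h1, max_eq_right ht, hw, inv_smul_smul₀ ht0.ne']

/-- Make the simplicial map continuous, fill it, and discretize the filling on a triangulation of
the ball with the prescribed boundary. -/
theorem asPiInftyVanishes_of_piInftyVanishes {X : Type*} [MetricSpace X] [ProperSpace X] {n : ℕ}
    (hX : UniformlyConnected n X) {i : ℕ} (hi : i ≤ n) (h : PiInftyVanishes i X) :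
    AsPiInftyVanishes i X := by
  classical
  intro r hr
  obtain ⟨R₂, hR₂, hnear⟩ := exists_continuous_near hX hi (r := r + 1) (by positivity)
  -- On simplices of the outer half the distance is at most `4 * R₂ + r`: `R₂` from `F` to `g'` and
  -- `R₂` from `g'` to `f ∘ φ` at each end, and `r` inside one simplex of `S`. On small simplices it
  -- is at most `2 * R₂ + 1`.
  refine ⟨4 * R₂ + r + 1, by positivity, fun K hK => ?_⟩
  obtain ⟨L, hL, hKL, hext⟩ := h (closure K) hK.isCompact_closure
  have hLsub : L ⊆ {x | ∃ k ∈ L, dist x k ≤ R₂} := fun x hx =>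
    ⟨x, hx, by rw [dist_self]; exact hR₂.le⟩
  refine ⟨_, isBounded_setOf_dist_le hL.isBounded R₂,
    (subset_closure.trans hKL).trans hLsub, fun S f hf => ?_⟩
  rw [isSimplicialMap_ripsComplex_iff] at hf
  obtain ⟨φ, hφ, δ, hδ, hφδ⟩ := S.exists_vertex_choice
  let g : EuclideanSpace ℝ (Fin (i + 1)) → X := fun y =>
    if hs : y ∈ USphere i then f (φ ⟨y, hs⟩) else f 0
  have hgs : ∀ s : USphere i, g s = f (φ s) := fun s => dif_pos s.2
  obtain ⟨g', hg'⟩ := (hnear g δ hδ).2 fun x hx y hy hxy => by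
    obtain ⟨s, hs, h1, h2⟩ := hφδ ⟨x, hx⟩ ⟨y, hy⟩ hxy
    have h3 := (hf s hs).2 _ h1 _ h2
    rw [hgs ⟨x, hx⟩, hgs ⟨y, hy⟩]
    linarith
  have hg'φ : ∀ s : USphere i, dist (g' s) (f (φ s)) < R₂ := fun s => hgs s ▸ hg' s
  obtain ⟨G, hGK, hGg⟩ := hext g' fun s hs => by
    obtain ⟨τ, hτ, h1, -⟩ := hφδ s s (by rwa [dist_self])
    refine (hf τ hτ).1 _ h1 ⟨g' s, hs, ?_⟩
    rw [dist_comm]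
    exact (hg'φ s).le
  obtain ⟨B, hSB, hB⟩ := exists_ball_triangulation S (G.comp (radialPush i)) one_pos
  have hpush : ∀ {w : UBall i} {z : USphere i} {t : ℝ}, 1 / 2 ≤ t → w.1 = t • z.1 →
      G (radialPush i w) = g' z := fun ht hw => by
    rw [radialPush_apply ht hw, hGg]
  -- On the boundary `F` has to equal `f`, not the approximation `g'`; this costs the error `R₂`.
  let F : ℕ → X := fun v => if {v} ∈ S.complex.faces then f v else
    if hv : {v} ∈ B.complex.faces then G (radialPush i (B.vertex hv)) else f v
  have hFf : ∀ v, {v} ∈ S.complex.faces → F v = f v := fun v hv => if_pos hv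
  have hFG : ∀ v, ∀ hv : {v} ∈ B.complex.faces,
      dist (F v) (G (radialPush i (B.vertex hv))) ≤ R₂ := by
    intro v hv
    by_cases hvS : {v} ∈ S.complex.faces
    · have h1 : B.vertex hv = sphereInclusion i (S.vertex hvS) := hSB.2 _ _ _
      have h2 : φ (S.vertex hvS) = v := by
        have := hφ (S.vertex hvS)
        rw [S.homeo_symm_vertex] at this
        by_contra hne
        rw [Pi.single_eq_of_ne hne] at this
        exact lt_irrefl _ this
      have h3 := hg'φ (S.vertex hvS)
      rw [h2] at h3
      have h4 : (B.vertex hv).1 = (1 : ℝ) • (S.vertex hvS).1 := by rw [one_smul, h1]; rfl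
      rw [hFf v hvS, hpush (by norm_num) h4, dist_comm]
      exact h3.le
    · have : F v = G (radialPush i (B.vertex hv)) := by
        simp only [F, if_neg hvS, dif_pos hv]
      rw [this, dist_self]
      exact hR₂.le
  refine ⟨B, F, hSB, isSimplicialMap_ripsComplex_iff.2 fun s hs => ⟨fun v hv hvK => ?_, ?_⟩, hFf⟩
  · by_cases hvS : {v} ∈ S.complex.faces
    · rw [hFf v hvS] at hvK
      exact (hf _ hvS).1 v (Finset.mem_singleton_self v) (hLsub (hKL (subset_closure hvK)))
    · have hvB := singleton_face hs hv
      have : F v = G (radialPush i (B.vertex hvB)) := by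
        simp only [F, if_neg hvS, dif_pos hvB]
      rw [this] at hvK
      exact hGK _ (subset_closure hvK)
  · intro u hu v hv
    have huB := singleton_face hs hu
    have hvB := singleton_face hs hv
    have h1 := hFG u huB
    have h2 := hFG v hvB
    rw [dist_comm] at h2
    rcases hB s hs with ⟨τ, hτ, hcol⟩ | hsmall
    · obtain ⟨z, t, ht, hz, hzτ⟩ := hcol u hu huB
      obtain ⟨z', t', ht', hz', hzτ'⟩ := hcol v hv hvB
      rw [hpush ht hz] at h1
      rw [hpush ht' hz'] at h2
      have h3 := (hf τ hτ).2 _ (hzτ _ (hφ z)) _ (hzτ' _ (hφ z'))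
      have h4 := hg'φ z
      have h5 := hg'φ z'
      rw [dist_comm] at h5
      have h6 := dist_triangle4 (F u) (g' z) (g' z') (F v)
      have h7 := dist_triangle4 (g' z) (f (φ z)) (f (φ z')) (g' z')
      linarith
    · have h3 : dist (G (radialPush i (B.vertex huB))) (G (radialPush i (B.vertex hvB))) < 1 :=
        hsmall u hu huB v hv hvB
      have h4 := dist_triangle4 (F u) (G (radialPush i (B.vertex huB)))
        (G (radialPush i (B.vertex hvB))) (F v)
      linarith

/-! ### Invariance under uniform equivalence -/

theorem isBounded_preimage_of_coarse_inverse {Z W : Type*} [MetricSpace Z] [MetricSpace W]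
    {p : Z → W} {q : W → Z} {c : ℝ} (hq : ∀ r, ∃ r', ∀ x y, dist x y ≤ r → dist (q x) (q y) ≤ r')
    (hqp : ∀ x, dist (q (p x)) x ≤ c) {K : Set W} (hK : Bornology.IsBounded K) :
    Bornology.IsBounded (p ⁻¹' K) := by
  obtain ⟨C, hC⟩ := Metric.isBounded_iff.1 hK
  obtain ⟨C', hC'⟩ := hq C
  refine Metric.isBounded_iff.2 ⟨c + C' + c, fun x hx y hy => ?_⟩
  have h1 := hC' _ _ (hC hx hy)
  have h2 := hqp x
  have h3 := hqp y
  rw [dist_comm] at h2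
  have h4 := dist_triangle4 x (q (p x)) (q (p y)) y
  linarith

/-- The asymptotic condition is transported by coarse maps that are inverse to each other up to
bounded distance. -/
theorem AsPiInftyVanishes.transfer {X Y : Type*} [MetricSpace X] [MetricSpace Y] {h : X → Y}
    {k : Y → X} {c : ℝ} (hc : 0 ≤ c)
    (hh : ∀ r, ∃ r', ∀ x y, dist x y ≤ r → dist (h x) (h y) ≤ r')
    (hk : ∀ r, ∃ r', ∀ x y, dist x y ≤ r → dist (k x) (k y) ≤ r')
    (hkh : ∀ x, dist (k (h x)) x ≤ c) (hhk : ∀ y, dist (h (k y)) y ≤ c) {i : ℕ}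
    (hX : AsPiInftyVanishes i X) : AsPiInftyVanishes i Y := by
  classical
  intro r _
  obtain ⟨r', hr'⟩ := hk r
  obtain ⟨R, hR, hX⟩ := hX (max r' 1) (lt_max_of_lt_right one_pos)
  obtain ⟨R', hR'⟩ := hh R
  refine ⟨max (R' + 2 * c) 1, lt_max_of_lt_right one_pos, fun K hK => ?_⟩
  obtain ⟨L, hL, -, hasph⟩ := hX (h ⁻¹' K) (isBounded_preimage_of_coarse_inverse hk hkh hK)
  -- Adding `K` also keeps the original values `f v`, which `F'` retains on the boundary, outside
  -- `K`.
  refine ⟨k ⁻¹' L ∪ K, (isBounded_preimage_of_coarse_inverse hh hhk hL).union hK, subset_union_right,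
    fun S f hf => ?_⟩
  rw [isSimplicialMap_ripsComplex_iff] at hf
  obtain ⟨B, F, hSB, hF, hFf⟩ := hasph S (fun v => k (f v)) (isSimplicialMap_ripsComplex_iff.2
    fun s hs => ⟨fun v hv hvL => (hf s hs).1 v hv (Or.inl hvL), fun u hu v hv =>
      (hr' _ _ ((hf s hs).2 u hu v hv)).trans (le_max_left _ _)⟩)
  rw [isSimplicialMap_ripsComplex_iff] at hF
  let F' : ℕ → Y := fun v => if {v} ∈ S.complex.faces then f v else h (F v)
  have hF'f : ∀ v, {v} ∈ S.complex.faces → F' v = f v := fun v hv => if_pos hv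
  have hF'F : ∀ v, dist (F' v) (h (F v)) ≤ c := by
    intro v
    by_cases hv : {v} ∈ S.complex.faces
    · rw [hF'f v hv, hFf v hv, dist_comm]
      exact hhk _
    · simp only [F', if_neg hv, dist_self]
      exact hc
  refine ⟨B, F', hSB, isSimplicialMap_ripsComplex_iff.2 fun s hs => ⟨fun v hv hvK => ?_,
    fun u hu v hv => ?_⟩, hF'f⟩
  · by_cases hvS : {v} ∈ S.complex.faces
    · rw [hF'f v hvS] at hvK
      exact (hf _ hvS).1 v (Finset.mem_singleton_self v) (Or.inr hvK)
    · simp only [F', if_neg hvS] at hvK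
      exact (hF s hs).1 v hv hvK
  · have h1 := hR' _ _ ((hF s hs).2 u hu v hv)
    have h2 := hF'F u
    have h3 := hF'F v
    rw [dist_comm] at h3
    have h4 := dist_triangle4 (F' u) (h (F u)) (h (F v)) (F' v)
    exact le_trans (by linarith) (le_max_left _ _)

/-- A choice `k` of approximate preimages is a coarse inverse of `h`: since `g₁` tends to infinity,
points with close images are close. The transfer then works in both directions. -/
theorem UniformlyEquivalent.asPiInftyVanishes_iff {X Y : Type*} [MetricSpace X] [MetricSpace Y]
    (hXY : UniformlyEquivalent X Y) (i : ℕ) : AsPiInftyVanishes i X ↔ AsPiInftyVanishes i Y := by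
  obtain ⟨h, g₁, g₂, N, -, hg₂, hg₁t, -, hN, hemb, hsurj⟩ := hXY
  choose k hk using hsurj
  have hinv : ∀ r, ∃ T, ∀ x y, dist (h x) (h y) ≤ r → dist x y ≤ T := by
    intro r
    obtain ⟨T, hT⟩ := (hg₁t.eventually (eventually_gt_atTop r)).exists_forall_of_atTop
    refine ⟨T, fun x y hxy => ?_⟩
    by_contra hlt
    exact absurd ((hT _ (not_le.1 hlt).le).trans_le ((hemb x y).1.trans hxy)) (lt_irrefl r)
  obtain ⟨T, hT⟩ := hinv N
  have hh : ∀ r, ∃ r', ∀ x y, dist x y ≤ r → dist (h x) (h y) ≤ r' := fun r =>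
    ⟨g₂ r, fun x y hxy => (hemb x y).2.trans (hg₂ hxy)⟩
  have hkc : ∀ r, ∃ r', ∀ x y, dist x y ≤ r → dist (k x) (k y) ≤ r' := by
    intro r
    -- `h (k x)` and `h (k y)` are within `N` of `x` and `y`.
    obtain ⟨T', hT'⟩ := hinv (N + r + N)
    refine ⟨T', fun x y hxy => hT' _ _ ?_⟩
    have h1 := hk x
    have h2 := hk y
    rw [dist_comm] at h1
    have h3 := dist_triangle4 (h (k x)) x y (h (k y))
    linarith
  have hkh : ∀ x, dist (k (h x)) x ≤ max N T := fun x =>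
    (hT _ _ (by rw [dist_comm]; exact hk (h x))).trans (le_max_right _ _)
  have hhk : ∀ y, dist (h (k y)) y ≤ max N T := fun y => by
    rw [dist_comm]
    exact (hk y).trans (le_max_left _ _)
  have hc : 0 ≤ max N T := hN.le.trans (le_max_left _ _)
  exact ⟨AsPiInftyVanishes.transfer hc hh hkc hkh hhk, AsPiInftyVanishes.transfer hc hkc hh hhk hkh⟩

theorem asPiInftyVanishes_iff_piInftyVanishes {X : Type*} [MetricSpace X] [ProperSpace X] {n : ℕ}
    (hX : UniformlyConnected n X) {i : ℕ} (hi : i ≤ n) :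
    AsPiInftyVanishes i X ↔ PiInftyVanishes i X :=
  ⟨piInftyVanishes_of_asPiInftyVanishes hX hi, asPiInftyVanishes_of_piInftyVanishes hX hi⟩

theorem mainTheorem10 (n : ℕ) :
    (∀ (X : Type*) [MetricSpace X] [ProperSpace X], UniformlyConnected n X →
      ∀ i ≤ n, (AsPiInftyVanishes i X ↔ PiInftyVanishes i X)) ∧
    (∀ (X : Type*) (X' : Type*) [MetricSpace X] [ProperSpace X] [MetricSpace X'] [ProperSpace X'],
      UniformlyConnected n X → UniformlyConnected n X' → UniformlyEquivalent X X' →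
      ∀ i ≤ n, (PiInftyVanishes i X ↔ PiInftyVanishes i X')) := by
  refine ⟨fun X _ _ hX i hi => asPiInftyVanishes_iff_piInftyVanishes hX hi,
    fun X X' _ _ _ _ hX hX' hXX' i hi => ?_⟩
  rw [← asPiInftyVanishes_iff_piInftyVanishes hX hi, ← asPiInftyVanishes_iff_piInftyVanishes hX' hi]
  exact hXX'.asPiInftyVanishes_iff i
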